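/- **Setting.** Let $\mathcal X\subset\mathbb R^{d_x}$ be convex, $f_1:\mathbb R^{d_y}\to\mathbb R$ convex and differentiable, and let $f_2:\mathbb R^{d_x}\to\mathbb R^{d_y}$ and $g=(g^{(1)},\dots,g^{(m)}):\mathbb R^{d_x}\to\mathbb R^m$ have convex components. Consider $\min_{x\in\mathcal X}F(x)=f_1(f_2(x))$ subject to $g(x)\le 0$, and let $(x^*,\lambda^*)\in\mathcal X\times\mathbb R^m_+$ be a saddle point of $\mathcal L(x,\lambda)=F(x)+\sum_j\lambda_jg^{(j)}(x)$, i.e. $\mathcal L(x^*,\lambda)\le\mathcal L(x^*,\lambda^*)\le\mathcal L(x,\lambda^*)$ for all $x\in\mathcal X$, $\lambda\in\mathbb R^m_+$. Here $\|\cdot\|$ is the Euclidean norm of vectors and the spectral norm of matrices, and $\partial h(x)$, for $h$ with convex components, is the set of matrices whose $j$-th column is a subgradient of $h_j$ at $x$. A sampling oracle returns sample values and (sub)gradients $f_1(y,\xi_1)$, $\nabla f_1(y,\xi_1)\in\mathbb R^{d_y}$, $f_2(x,\xi_2)$, $\partial f_2(x,\xi_2)\in\mathbb R^{d_x\times d_y}$,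 $g(x,\zeta)$, $\partial g(x,\zeta)\in\mathbb R^{d_x\times m}$, all with finite second moments. Let $C_{f_1},C_{f_2},\sigma_{f_1},\sigma_{f_2},L_{f_1},D_X,C_g,\sigma_g$ be positive constants. **Assumption 1.** $\|x-x^*\|\le D_X$ for all $x\in\mathcal X$; $\nabla f_1$ is $L_{f_1}$-Lipschitz; for all $x\in\mathcal X$, $\mathbb E f_2(x,\xi_2)=f_2(x)$, $\mathbb E\|f_2(x,\xi_2)-f_2(x)\|^2\le\sigma_{f_2}^2$, $\mathbb E\,\partial f_2(x,\xi_2)\in\partial f_2(x)$, $\mathbb E\|\partial f_2(x,\xi_2)\|^2\le C_{f_2}^2$; for all $y\in\mathbb R^{d_y}$, $\mathbb E f_1(y,\xi_1)=f_1(y)$, $\mathbb E|f_1(y,\xi_1)-f_1(y)|^2\le\sigma_{f_1}^2$, $\mathbb E\nabla f_1(y,\xi_1)=\nabla f_1(y)$, $\mathbb E\|\nabla f_1(y,\xi_1)\|^2\le C_{f_1}^2$. **Assumption 2.** For all $x\in\mathcal X$, $\mathbb E g(x,\zeta)=g(x)$, $\mathbb E\|g(x,\zeta)-g(x)\|^2\le\sigma_g^2$,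 $\mathbb E\,\partial g(x,\zeta)\in\partial g(x)$, $\mathbb E\|\partial g(x,\zeta)\|^2\le C_g^2$. **Assumption 3.** If $f_2$ is not affine, then $\nabla f_1(y)\ge0$ componentwise for all $y\in\mathbb R^{d_y}$. **Algorithm (EC-SCGD).** Given $x_0\in\mathcal X$, $y_0=0$, $\lambda_0\in\mathbb R^m_+$, for $t=0,\dots,N-1$ draw samples $\xi_{1,t}$, $\xi_{2,t}^0$, $\xi_{2,t}^1$, $\zeta_t^0$, $\zeta_t^1$, with the laws of $\xi_1,\xi_2,\xi_2,\zeta,\zeta$ and all mutually independent, and set $$y_{t+1}=\frac{f_2(x_t,\xi_{2,t}^1)+\tau_ty_t}{1+\tau_t},\qquad x_{t+1}=\mathrm{Proj}_{\mathcal X}\Big[x_t-\tfrac1{\eta_t}\big(\partial f_2(x_t,\xi_{2,t}^0)\nabla f_1(y_{t+1},\xi_{1,t})+\partial g(x_t,\zeta_t^0)\lambda_t\big)\Big],\qquad \lambda_{t+1}=\Big[\lambda_t+\tfrac1{\alpha_t}g(x_t,\zeta_t^1)\Big]_+ .$$ **Theorem.** Suppose Assumptions 1–3 hold and the algorithm is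 run for $N\ge 3C_g^2/2$ iterations with $\lambda_0=0$, $\tau_t=t/2$, $\alpha_t=2\sqrt N$, $\eta_t=15\sqrt N/2$. Let $\bar x_N=\frac1N\sum_{t=1}^Nx_t$ and $$R=6C_{f_1}^2C_{f_2}^2+\tfrac{D_X^2C_g^2}2+2C_g^2\|\lambda^*\|^2+\tfrac{\sigma_g^2}2+L_{f_1}\sigma_{f_2}^2+3C_{f_1}\sigma_{f_2}+\|\lambda^*\|\sigma_g+\tfrac{15}4\|x_0-x^*\|^2+\|\lambda_0-\lambda^*\|^2 .$$ Then $F(\bar x_N)$ and $\|g(\bar x_N)_+\|$ are integrable, $$\mathbb E[F(\bar x_N)]-F(x^*)\le\frac1{\sqrt N}\Big(6C_{f_1}^2C_{f_2}^2+L_{f_1}\sigma_{f_2}^2+3C_{f_1}\sigma_{f_2}+\tfrac{15}4\|x_0-x^*\|^2+\tfrac{D_X^2C_g^2}2+\tfrac{\sigma_g^2}2+\tfrac{(4\|\lambda^*\|^2+8Re^{2C_g^2})C_g^2}3\Big)$$ and $$\mathbb E\|g(\bar x_N)_+\|\le\frac1{\sqrt N}\Big(6C_{f_1}^2C_{f_2}^2+L_{f_1}\sigma_{f_2}^2+3C_{f_1}\sigma_{f_2}+\tfrac{15}4\|x_0-x^*\|^2+\tfrac{D_X^2C_g^2}2+\tfrac{\sigma_g^2}2+(2\|\lambda^*\|^2+4Re^{2C_g^2})C_g^2+(2C_g^2+1)(\|\lambda^*\|+1)^2+(\|\lambda^*\|+1)\sigma_g\Big).$$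 -/

import Mathlib

open MeasureTheory ProbabilityTheory

noncomputable section

namespace ECSCO

/-- Euclidean space `ℝⁿ`. -/
abbrev Vec (n : ℕ) : Type := EuclideanSpace ℝ (Fin n)

/-- Real `n × k` matrices, regarded as linear maps `ℝᵏ → ℝⁿ`; the norm is the spectral norm. The
`j`-th column of `A` is `A (EuclideanSpace.single j 1)`. -/
abbrev Mat (n k : ℕ) : Type := Vec k →L[ℝ] Vec n

/-- The nonnegative orthant `ℝᵐ₊`. -/
def nonnegOrthant (m : ℕ) : Set (Vec m) := {l | ∀ j, 0 ≤ l j}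

/-- The componentwise positive part `[u]₊ = max {u, 0}`. -/
def vecPos {m : ℕ} (u : Vec m) : Vec m := WithLp.toLp 2 (fun j => max (u j) 0)

/-- The subdifferential at `x` of a vector-valued function with convex components: the set of
matrices whose `j`-th column is a subgradient of the `j`-th component at `x`. -/
def subdifferential {n k : ℕ} (h : Vec n → Vec k) (x : Vec n) : Set (Mat n k) :=
  {A | ∀ j, ∀ z, h x j + inner ℝ (A (EuclideanSpace.single j 1)) (z - x) ≤ h z j}

/-- `p` is the Euclidean projection of `u` onto `X`. -/
def IsProjection {n : ℕ} (X : Set (Vec n)) (u p : Vec n) : Prop :=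
  p ∈ X ∧ ∀ z ∈ X, ‖u - p‖ ≤ ‖u - z‖

/-- The data of a problem `min f₁ (f₂ x)` over `x ∈ X` subject to `g x ≤ 0`, together with the
answers of a sampling oracle: sample values `f₁(y,ξ₁)`, `f₂(x,ξ₂)`, `g(x,ζ)`, sample gradients
`∇f₁(y,ξ₁)` and sample subgradients `∂f₂(x,ξ₂)`, `∂g(x,ζ)`. -/
structure Problem (dx dy m : ℕ) (Ξ₁ Ξ₂ Z : Type*) where
  X : Set (Vec dx)
  f₁ : Vec dy → ℝ
  f₂ : Vec dx → Vec dy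
  g : Vec dx → Vec m
  f₁val : Vec dy → Ξ₁ → ℝ
  f₁grad : Vec dy → Ξ₁ → Vec dy
  f₂val : Vec dx → Ξ₂ → Vec dy
  f₂sub : Vec dx → Ξ₂ → Mat dx dy
  gval : Vec dx → Z → Vec m
  gsub : Vec dx → Z → Mat dx m

section

variable {dx dy m : ℕ} {Ξ₁ Ξ₂ Z Ω : Type*}

/-- The objective `F = f₁ ∘ f₂`. -/
def Problem.F (P : Problem dx dy m Ξ₁ Ξ₂ Z) (x : Vec dx) : ℝ := P.f₁ (P.f₂ x)

/-- The Lagrangian `L(x, λ) = F(x) + ∑ⱼ λⱼ g⁽ʲ⁾(x)`. -/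
def Problem.lagrangian (P : Problem dx dy m Ξ₁ Ξ₂ Z) (x : Vec dx) (l : Vec m) : ℝ :=
  P.F x + ∑ j, l j * P.g x j

/-- `(xs, ls)` is a saddle point of the Lagrangian over `X × ℝᵐ₊`. -/
structure Problem.IsSaddle (P : Problem dx dy m Ξ₁ Ξ₂ Z) (xs : Vec dx) (ls : Vec m) : Prop where
  primal_mem : xs ∈ P.X
  dual_mem : ls ∈ nonnegOrthant m
  saddle : ∀ x ∈ P.X, ∀ l ∈ nonnegOrthant m,
    P.lagrangian xs l ≤ P.lagrangian xs ls ∧ P.lagrangian xs ls ≤ P.lagrangian x ls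

variable [MeasurableSpace Ξ₁] [MeasurableSpace Ξ₂] [MeasurableSpace Z] [MeasurableSpace Ω]

/-- The answers that the algorithm uses are jointly measurable in the query point and the sample. -/
structure Problem.MeasurableOracle (P : Problem dx dy m Ξ₁ Ξ₂ Z) : Prop where
  f₁grad : Measurable fun p : Vec dy × Ξ₁ => P.f₁grad p.1 p.2
  f₂val : Measurable fun p : Vec dx × Ξ₂ => P.f₂val p.1 p.2
  f₂sub : Measurable fun p : Vec dx × Ξ₂ => P.f₂sub p.1 p.2
  gval : Measurable fun p : Vec dx × Z => P.gval p.1 p.2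
  gsub : Measurable fun p : Vec dx × Z => P.gsub p.1 p.2

/-- The assumption on the feasible set and the objective; `P₁`, `P₂` are the laws of `ξ₁`, `ξ₂`.
(A finite convex function on the whole of `ℝⁿ` is automatically the maximum of the affine functions
given by its Fenchel conjugate, so that convexity is all that has to be said about this.) -/
structure Problem.ObjectiveAssumption (P : Problem dx dy m Ξ₁ Ξ₂ Z)
    (P₁ : Measure Ξ₁) (P₂ : Measure Ξ₂) (xs : Vec dx)
    (Cf₁ Cf₂ σf₁ σf₂ Lf₁ DX : ℝ) : Prop where
  Cf₁_pos : 0 < Cf₁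
  Cf₂_pos : 0 < Cf₂
  σf₁_pos : 0 < σf₁
  σf₂_pos : 0 < σf₂
  Lf₁_pos : 0 < Lf₁
  DX_pos : 0 < DX
  convex_X : Convex ℝ P.X
  bounded_X : ∀ x ∈ P.X, ‖x - xs‖ ≤ DX
  convex_f₁ : ConvexOn ℝ Set.univ P.f₁
  convex_f₂ : ∀ j, ConvexOn ℝ Set.univ fun x => P.f₂ x j
  differentiable_f₁ : Differentiable ℝ P.f₁
  smooth_f₁ : ∀ y₁ y₂, ‖gradient P.f₁ y₁ - gradient P.f₁ y₂‖ ≤ Lf₁ * ‖y₁ - y₂‖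
  f₂val_memLp : ∀ x ∈ P.X, MemLp (P.f₂val x) 2 P₂
  f₂val_mean : ∀ x ∈ P.X, ∫ ξ, P.f₂val x ξ ∂P₂ = P.f₂ x
  f₂val_var : ∀ x ∈ P.X, ∫ ξ, ‖P.f₂val x ξ - P.f₂ x‖ ^ 2 ∂P₂ ≤ σf₂ ^ 2
  f₁val_memLp : ∀ y, MemLp (P.f₁val y) 2 P₁
  f₁val_mean : ∀ y, ∫ ξ, P.f₁val y ξ ∂P₁ = P.f₁ y
  f₁val_var : ∀ y, ∫ ξ, ‖P.f₁val y ξ - P.f₁ y‖ ^ 2 ∂P₁ ≤ σf₁ ^ 2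
  f₂sub_memLp : ∀ x ∈ P.X, MemLp (P.f₂sub x) 2 P₂
  f₂sub_mean : ∀ x ∈ P.X, ∫ ξ, P.f₂sub x ξ ∂P₂ ∈ subdifferential P.f₂ x
  f₂sub_moment : ∀ x ∈ P.X, ∫ ξ, ‖P.f₂sub x ξ‖ ^ 2 ∂P₂ ≤ Cf₂ ^ 2
  f₁grad_memLp : ∀ y, MemLp (P.f₁grad y) 2 P₁
  f₁grad_mean : ∀ y, ∫ ξ, P.f₁grad y ξ ∂P₁ = gradient P.f₁ y
  f₁grad_moment : ∀ y, ∫ ξ, ‖P.f₁grad y ξ‖ ^ 2 ∂P₁ ≤ Cf₁ ^ 2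

/-- The assumption on the constraints; `PZ` is the law of `ζ`. -/
structure Problem.ConstraintAssumption (P : Problem dx dy m Ξ₁ Ξ₂ Z) (PZ : Measure Z)
    (Cg σg : ℝ) : Prop where
  Cg_pos : 0 < Cg
  σg_pos : 0 < σg
  convex_g : ∀ j, ConvexOn ℝ Set.univ fun x => P.g x j
  gval_memLp : ∀ x ∈ P.X, MemLp (P.gval x) 2 PZ
  gval_mean : ∀ x ∈ P.X, ∫ ζ, P.gval x ζ ∂PZ = P.g x
  gval_var : ∀ x ∈ P.X, ∫ ζ, ‖P.gval x ζ - P.g x‖ ^ 2 ∂PZ ≤ σg ^ 2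
  gsub_memLp : ∀ x ∈ P.X, MemLp (P.gsub x) 2 PZ
  gsub_mean : ∀ x ∈ P.X, ∫ ζ, P.gsub x ζ ∂PZ ∈ subdifferential P.g x
  gsub_moment : ∀ x ∈ P.X, ∫ ζ, ‖P.gsub x ζ‖ ^ 2 ∂PZ ≤ Cg ^ 2

/-- If the inner function is not affine, the gradient of the outer one is componentwise
nonnegative. -/
def Problem.MonotoneAssumption (P : Problem dx dy m Ξ₁ Ξ₂ Z) : Prop :=
  (¬ ∃ A : Vec dx →ᵃ[ℝ] Vec dy, ∀ x, P.f₂ x = A x) → ∀ y j, 0 ≤ gradient P.f₁ y j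

/-- The oracle queries of one iteration, by the sample that they draw: `ξ₁`, `ξ₂ⁱ` and `ζⁱ`, where
`i = 0` serves for (sub)gradients and `i = 1` for values. -/
inductive Query where
  | outer : Query
  | inner (i : Fin 2) : Query
  | constr (i : Fin 2) : Query

/-- The σ-algebra generated by the sample of the query `q` at iteration `t`. -/
@[reducible] def sampleSigma (ξ₁ : ℕ → Ω → Ξ₁) (ξ₂ : ℕ → Fin 2 → Ω → Ξ₂) (ζ : ℕ → Fin 2 → Ω → Z) (t : ℕ)
    (q : Query) : MeasurableSpace Ω :=
  match q with
  | Query.outer => MeasurableSpace.comap (ξ₁ t) inferInstance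
  | Query.inner i => MeasurableSpace.comap (ξ₂ t i) inferInstance
  | Query.constr i => MeasurableSpace.comap (ζ t i) inferInstance

/-- The samples drawn in the iterations `t = 0, …, N - 1` have the laws `P₁`, `P₂`, `PZ`
respectively, and all of them are mutually independent. -/
structure IndependentSamples (μ : Measure Ω) (P₁ : Measure Ξ₁) (P₂ : Measure Ξ₂) (PZ : Measure Z)
    (N : ℕ) (ξ₁ : ℕ → Ω → Ξ₁) (ξ₂ : ℕ → Fin 2 → Ω → Ξ₂) (ζ : ℕ → Fin 2 → Ω → Z) : Prop where
  law_ξ₁ : ∀ t < N, MeasurePreserving (ξ₁ t) μ P₁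
  law_ξ₂ : ∀ t < N, ∀ i, MeasurePreserving (ξ₂ t i) μ P₂
  law_ζ : ∀ t < N, ∀ i, MeasurePreserving (ζ t i) μ PZ
  indep : iIndep (fun q : Fin N × Query => sampleSigma ξ₁ ξ₂ ζ q.1 q.2) μ

end

section

variable {dx dy m : ℕ} {Ξ₁ Ξ₂ Z Ω : Type*}

/-- `(x, y, lam)` are the iterates of `N` steps of the expected value constrained stochastic
compositional gradient descent method with parameters `τ`, `α`, `η`, started at `x₀`, `y₀ = 0` and
`lam₀`, and fed with the samples `ξ₁`, `ξ₂`, `ζ`. -/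
structure Problem.IsECSCGD (P : Problem dx dy m Ξ₁ Ξ₂ Z) (N : ℕ) (τ α η : ℕ → ℝ)
    (x₀ : Vec dx) (lam₀ : Vec m)
    (ξ₁ : ℕ → Ω → Ξ₁) (ξ₂ : ℕ → Fin 2 → Ω → Ξ₂) (ζ : ℕ → Fin 2 → Ω → Z)
    (x : ℕ → Ω → Vec dx) (y : ℕ → Ω → Vec dy) (lam : ℕ → Ω → Vec m) : Prop where
  x₀_mem : x₀ ∈ P.X
  lam₀_mem : lam₀ ∈ nonnegOrthant m
  x_zero : ∀ ω, x 0 ω = x₀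
  y_zero : ∀ ω, y 0 ω = 0
  lam_zero : ∀ ω, lam 0 ω = lam₀
  y_step : ∀ t < N, ∀ ω,
    y (t + 1) ω = (1 + τ t)⁻¹ • (P.f₂val (x t ω) (ξ₂ t 1 ω) + τ t • y t ω)
  x_step : ∀ t < N, ∀ ω,
    IsProjection P.X
      (x t ω - (η t)⁻¹ • (P.f₂sub (x t ω) (ξ₂ t 0 ω) (P.f₁grad (y (t + 1) ω) (ξ₁ t ω))
        + P.gsub (x t ω) (ζ t 0 ω) (lam t ω)))
      (x (t + 1) ω)
  lam_step : ∀ t < N, ∀ ω,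
    lam (t + 1) ω = vecPos (lam t ω + (α t)⁻¹ • P.gval (x t ω) (ζ t 1 ω))

end

/-- The ergodic average `(1/N) ∑_{t=1}^N x_t`. -/
def ergodicAverage {n : ℕ} {Ω : Type*} (N : ℕ) (x : ℕ → Ω → Vec n) (ω : Ω) : Vec n :=
  (N : ℝ)⁻¹ • ∑ t ∈ Finset.Icc 1 N, x t ω

/-- The constant `R` of the rates. -/
def rateR {dx m : ℕ} (Cf₁ Cf₂ σf₂ Lf₁ DX Cg σg : ℝ) (x₀ xs : Vec dx) (lam₀ ls : Vec m) : ℝ :=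
  6 * Cf₁ ^ 2 * Cf₂ ^ 2 + DX ^ 2 * Cg ^ 2 / 2 + 2 * Cg ^ 2 * ‖ls‖ ^ 2 + σg ^ 2 / 2
    + Lf₁ * σf₂ ^ 2 + 3 * Cf₁ * σf₂ + ‖ls‖ * σg
    + 15 / 4 * ‖x₀ - xs‖ ^ 2 + ‖lam₀ - ls‖ ^ 2

end ECSCO

end

namespace ECSCO

set_option linter.unusedSectionVars false

/-! ### Smooth convex functions: descent and cocoercivity. -/

section SmoothConvex

variable {E : Type*} [NormedAddCommGroup E] [InnerProductSpace ℝ E] [CompleteSpace E]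

/-! Write s = √N and let x̄ be the average of x₁, …, x_T. Everything follows from one bound on T
(F(x̄) - F(x*) + ⟨l, g(x̄)⟩) + s ‖λ_T - l‖², valid for every l ≥ 0 with ‖l‖ ≤ c, even if l is chosen
after the run. Along a fixed sample path (`pathwise_gap`) it is the sum of three estimates: the
averaging of the inner values, with f₁ linearized at f₂(x̄) (`averaging_inequality`); projected dual
ascent (`dual_telescope`); and the projected primal step (`IsProjection.prox_inequality`). The
negative quadratic term of the last one pays for the squared step directions and for the mismatch
that x̄ averages x_{t+1} while the oracle is queried at x_t.

The delicate point is that y_{t+1} already contains the noise of the value f₂(x_t, ξ), so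
∇f₁(y_{t+1}) is not orthogonal to that noise. Replacing it by ∇f₁(y_t) leaves the product of
∇f₁(y_t) - ∇f₁(y_{t+1}) with the noise. Telescoping Bregman distances with weights t/2 leaves a
cocoercivity gain t/(4L) ‖∇f₁(y_t) - ∇f₁(y_{t+1})‖², which absorbs this product at the price L/t
‖noise‖²; the sum of 1/t is at most √T.

In expectation the sampled directions contribute nothing positive, by the subgradient inequalities.
The noise still paired with path-dependent vectors (∇f₁(f₂(x̄)) and l) enters only through the norm
of its sum, which is of order √T because the noise terms are orthogonal (`integral_norm_sum_le`).
This gives `Run.expected_gap`: a bound of order s plus a multiple of s⁻¹ ∑ E‖λ_t‖².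

For l = λ* the gap is nonnegative, so E‖λ_T - λ*‖² obeys a discrete Gronwall inequality with rate of
order 1/N and stays bounded (`Run.integral_lam_sub_sq_le`). Putting this back at T = N bounds the
expected gap by a multiple of 1/√N. The choice l = 0 gives the objective; l of norm ‖λ*‖ + 1 in the
direction of g(x̄)₊ gives the infeasibility. -/

theorem hasDerivAt_comp_line {f : E → ℝ} (hd : Differentiable ℝ f) (y d : E) (t : ℝ) :
    HasDerivAt (fun t : ℝ => f (y + t • d)) (inner ℝ (gradient f (y + t • d)) d) t := by
  have h1 : HasDerivAt (fun t : ℝ => y + t • d) d t := by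
    simpa using ((hasDerivAt_id t).smul_const d).const_add y
  have h2 := (hd (y + t • d)).hasFDerivAt.comp_hasDerivAt t h1
  rwa [← inner_gradient_left] at h2

theorem gradient_inequality {f : E → ℝ} (hf : ConvexOn ℝ Set.univ f) (hd : Differentiable ℝ f)
    (y z : E) : f y + inner ℝ (gradient f y) (z - y) ≤ f z := by
  have h0 := hasDerivAt_comp_line hd y (z - y) 0
  have hc : ConvexOn ℝ Set.univ (fun t : ℝ => f (y + t • (z - y))) := by
    have := hf.comp_affineMap (AffineMap.lineMap y z : ℝ →ᵃ[ℝ] E)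
    simp only [Set.preimage_univ] at this
    refine this.congr fun t _ => ?_
    simp [AffineMap.lineMap_apply, add_comm]
  have := hc.le_slope_of_hasDerivAt (Set.mem_univ 0) (Set.mem_univ 1) zero_lt_one h0
  simp only [slope_def_field, zero_smul, add_zero, one_smul, add_sub_cancel, sub_zero, div_one]
    at this
  linarith

/-- On the segment from y to z, f minus its quadratic upper model has nonpositive derivative by the
Lipschitz bound, hence decreases. -/
theorem descent_inequality {f : E → ℝ} {L : ℝ} (hd : Differentiable ℝ f)
    (hL : ∀ y z, ‖gradient f y - gradient f z‖ ≤ L * ‖y - z‖) (y z : E) :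
    f z ≤ f y + inner ℝ (gradient f y) (z - y) + L / 2 * ‖z - y‖ ^ 2 := by
  set d := z - y with hdd
  let φ : ℝ → ℝ := fun t => f (y + t • d) - t * inner ℝ (gradient f y) d - t ^ 2 * (L / 2 * ‖d‖ ^ 2)
  have hφ : ∀ t, HasDerivAt φ (inner ℝ (gradient f (y + t • d)) d - inner ℝ (gradient f y) d
      - 2 * t * (L / 2 * ‖d‖ ^ 2)) t := by
    intro t
    refine ((hasDerivAt_comp_line hd y d t).sub ?_).sub ?_
    · simpa using (hasDerivAt_id t).mul_const (inner ℝ (gradient f y) d)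
    · simpa using (hasDerivAt_pow 2 t).mul_const (L / 2 * ‖d‖ ^ 2)
  have hanti : AntitoneOn φ (Set.Icc 0 1) := by
    refine antitoneOn_of_deriv_nonpos (convex_Icc 0 1)
      (fun t _ => (hφ t).continuousAt.continuousWithinAt)
      (fun t _ => (hφ t).differentiableAt.differentiableWithinAt) ?_
    intro t ht
    rw [interior_Icc] at ht
    rw [(hφ t).deriv, ← inner_sub_left]
    have h1 := real_inner_le_norm (gradient f (y + t • d) - gradient f y) d
    have h2 := hL (y + t • d) y
    rw [add_sub_cancel_left, norm_smul, Real.norm_of_nonneg ht.1.le] at h2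
    nlinarith [mul_le_mul_of_nonneg_right h2 (norm_nonneg d)]
  have := hanti (Set.left_mem_Icc.2 zero_le_one) (Set.right_mem_Icc.2 zero_le_one) zero_le_one
  simp only [φ, one_smul, zero_smul, add_zero, hdd, add_sub_cancel] at this
  rw [← hdd] at this
  linarith

/-- The gradient inequality at y and the descent inequality at z are compared at the gradient step z
- L⁻¹ (∇f z - ∇f y). -/
theorem cocoercive_inequality {f : E → ℝ} {L : ℝ} (hL0 : 0 < L) (hf : ConvexOn ℝ Set.univ f)
    (hd : Differentiable ℝ f) (hL : ∀ y z, ‖gradient f y - gradient f z‖ ≤ L * ‖y - z‖) (y z : E) :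
    f y + inner ℝ (gradient f y) (z - y) + 1 / (2 * L) * ‖gradient f y - gradient f z‖ ^ 2
      ≤ f z := by
  set v := gradient f z - gradient f y with hv
  have h1 := descent_inequality hd hL z (z - L⁻¹ • v)
  have h2 := gradient_inequality hf hd y (z - L⁻¹ • v)
  have e1 : z - L⁻¹ • v - z = -(L⁻¹ • v) := by abel
  have e2 : z - L⁻¹ • v - y = (z - y) - L⁻¹ • v := by abel
  rw [e1, norm_neg, norm_smul, inner_neg_right, inner_smul_right, Real.norm_of_nonneg
    (inv_pos.2 hL0).le] at h1
  rw [e2, inner_sub_right, inner_smul_right] at h2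
  have h3 : inner ℝ (gradient f z) v - inner ℝ (gradient f y) v = ‖v‖ ^ 2 := by
    rw [← inner_sub_left, ← hv, real_inner_self_eq_norm_sq]
  have h4 : ‖gradient f y - gradient f z‖ = ‖v‖ := by rw [hv, norm_sub_rev]
  rw [h4]
  have h5 : L / 2 * (L⁻¹ * ‖v‖) ^ 2 = 1 / (2 * L) * ‖v‖ ^ 2 := by field_simp
  have h6 : L⁻¹ * inner ℝ (gradient f z) v = L⁻¹ * inner ℝ (gradient f y) v + L⁻¹ * ‖v‖ ^ 2 := by
    rw [← h3]; ring
  have h7 : L⁻¹ * ‖v‖ ^ 2 = 2 * (1 / (2 * L) * ‖v‖ ^ 2) := by field_simp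
  linarith

end SmoothConvex

/-! ### Averaged inner values and the outer function. -/

section Outer

variable {E : Type*} [NormedAddCommGroup E] [InnerProductSpace ℝ E]

/-- Telescoping of the Bregman distances along the averaged inner values `y`. -/
theorem averaging_telescope {f : E → ℝ} {G : E → E} {L : ℝ} (hL0 : 0 < L)
    (hG : ∀ y z, f y + inner ℝ (G y) (z - y) + 1 / (2 * L) * ‖G y - G z‖ ^ 2 ≤ f z)
    (h y : ℕ → E) (p : E) (T : ℕ)
    (hy : ∀ t < T, y (t + 1) = (1 + (t : ℝ) / 2)⁻¹ • (h t + ((t : ℝ) / 2) • y t)) :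
    ∑ t ∈ Finset.range T, (f p + inner ℝ (G p) (h t - p))
      + (T : ℝ) / 2 * (f (y T) - f p - inner ℝ (G p) (y T - p)) ≤
    ∑ t ∈ Finset.range T, (f (y (t + 1)) + inner ℝ (G (y (t + 1))) (h t - y (t + 1))
      - (t : ℝ) / (4 * L) * ‖G (y t) - G (y (t + 1))‖ ^ 2) := by
  induction T with
  | zero => simp
  | succ T ih =>
    have ih := ih fun t ht => hy t (by omega)
    rw [Finset.sum_range_succ, Finset.sum_range_succ]
    have hT : (0 : ℝ) ≤ T := Nat.cast_nonneg T
    -- The averaging rule solved for the sample: h T extrapolates beyond y (T + 1). An affine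
    -- function at h T is therefore 1 + T/2 times its value at y (T + 1) minus T/2 times its value
    -- at y T, which makes the Bregman distances telescope.
    have e : h T = y (T + 1) + ((T : ℝ) / 2) • (y (T + 1) - y T) := by
      have h1 : (1 + (T : ℝ) / 2) • y (T + 1) = h T + ((T : ℝ) / 2) • y T := by
        rw [hy T (by omega), smul_smul, mul_inv_cancel₀ (by positivity), one_smul]
      rw [add_smul, one_smul] at h1
      rw [smul_sub, ← add_sub_assoc, h1, add_sub_cancel_right]
    -- Cocoercivity between consecutive averages, weighted by T/2, produces the negative squared
    -- gradient differences. At p only the gradient inequality is needed.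
    have c1 := hG (y (T + 1)) (y T)
    have c2 := hG p (y (T + 1))
    have c3 : 0 ≤ 1 / (2 * L) * ‖G p - G (y (T + 1))‖ ^ 2 := by positivity
    rw [norm_sub_rev] at c1
    have e1 : (T : ℝ) / (4 * L) * ‖G (y T) - G (y (T + 1))‖ ^ 2
        = (T : ℝ) / 2 * (1 / (2 * L) * ‖G (y T) - G (y (T + 1))‖ ^ 2) := by field_simp; ring
    rw [e1]
    have c1' := mul_le_mul_of_nonneg_left c1 (by positivity : 0 ≤ (T : ℝ) / 2)
    rw [e]
    simp only [inner_sub_right, inner_add_right, inner_smul_right] at *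
    push_cast
    nlinarith

/-- Here q stands for exact inner values and h for sampled ones. The noise q - h is paired with G (y
t) rather than G (y (t + 1)), because only the former is determined before the noise. Young's
inequality absorbs the difference into the gain of `averaging_telescope`. The vector G p may depend
on the whole path, hence the norm of the summed noise. -/
theorem averaging_inequality {f : E → ℝ} {G : E → E} {L C : ℝ} (hL0 : 0 < L)
    (hG : ∀ y z, f y + inner ℝ (G y) (z - y) + 1 / (2 * L) * ‖G y - G z‖ ^ 2 ≤ f z)
    (hC : ∀ y, ‖G y‖ ≤ C)
    (q h y : ℕ → E) (p ys : E) (T : ℕ)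
    (hy : ∀ t < T, y (t + 1) = (1 + (t : ℝ) / 2)⁻¹ • (h t + ((t : ℝ) / 2) • y t)) :
    ∑ t ∈ Finset.range T, (f p + inner ℝ (G p) (q t - p)) ≤
    ∑ t ∈ Finset.range T, (f ys + inner ℝ (G (y (t + 1))) (q t - ys)
      - inner ℝ (G (y t)) (q t - h t) + L / t * ‖q t - h t‖ ^ 2
      + if t = 0 then 2 * C * ‖q t - h t‖ else 0)
      + C * ‖∑ t ∈ Finset.range T, (q t - h t)‖ := by
  have hG' : ∀ y z, f y + inner ℝ (G y) (z - y) ≤ f z := fun y z =>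
    le_trans (le_add_of_nonneg_right (by positivity)) (hG y z)
  have key := averaging_telescope hL0 hG h y p T hy
  have hA : 0 ≤ (T : ℝ) / 2 * (f (y T) - f p - inner ℝ (G p) (y T - p)) :=
    mul_nonneg (by positivity) (by linarith [hG' p (y T)])
  have h1 : ∑ t ∈ Finset.range T, (f p + inner ℝ (G p) (q t - p))
      = ∑ t ∈ Finset.range T, (f p + inner ℝ (G p) (h t - p))
        + inner ℝ (G p) (∑ t ∈ Finset.range T, (q t - h t)) := by
    rw [inner_sum, ← Finset.sum_add_distrib]
    refine Finset.sum_congr rfl fun t _ => ?_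
    simp only [inner_sub_right]; ring
  have h2 : inner ℝ (G p) (∑ t ∈ Finset.range T, (q t - h t))
      ≤ C * ‖∑ t ∈ Finset.range T, (q t - h t)‖ :=
    (real_inner_le_norm _ _).trans (mul_le_mul_of_nonneg_right (hC p) (norm_nonneg _))
  have h3 : ∑ t ∈ Finset.range T, (f (y (t + 1)) + inner ℝ (G (y (t + 1))) (h t - y (t + 1))
      - (t : ℝ) / (4 * L) * ‖G (y t) - G (y (t + 1))‖ ^ 2) ≤
      ∑ t ∈ Finset.range T, (f ys + inner ℝ (G (y (t + 1))) (q t - ys)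
      - inner ℝ (G (y t)) (q t - h t) + L / t * ‖q t - h t‖ ^ 2
      + if t = 0 then 2 * C * ‖q t - h t‖ else 0) := by
    refine Finset.sum_le_sum fun t _ => ?_
    have c1 := hG' (y (t + 1)) ys
    have c2 := real_inner_le_norm (G (y t) - G (y (t + 1))) (q t - h t)
    have c3 : ‖G (y t) - G (y (t + 1))‖ * ‖q t - h t‖ ≤
        (t : ℝ) / (4 * L) * ‖G (y t) - G (y (t + 1))‖ ^ 2 + L / t * ‖q t - h t‖ ^ 2
        + if t = 0 then 2 * C * ‖q t - h t‖ else 0 := by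
      -- At t = 0 the gain has weight zero and L / t is 0 by convention, so the product is bounded
      -- crudely by 2C times the noise; this happens only once.
      split_ifs with ht
      · subst ht
        have := norm_sub_le (G (y 0)) (G (y (0 + 1)))
        have := mul_le_mul_of_nonneg_right
          (this.trans (add_le_add (hC (y 0)) (hC (y (0 + 1))))) (norm_nonneg (q 0 - h 0))
        simp only [Nat.cast_zero, zero_div, div_zero, zero_mul, zero_add] at *
        linarith
      · have ht0 : (0 : ℝ) < t := by exact_mod_cast Nat.pos_of_ne_zero ht
        set a := ‖G (y t) - G (y (t + 1))‖
        set b := ‖q t - h t‖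
        have : (t : ℝ) / (4 * L) * a ^ 2 + L / t * b ^ 2 - a * b
            = (t * a - 2 * L * b) ^ 2 / (4 * L * t) := by field_simp; ring
        have h0 : 0 ≤ (t * a - 2 * L * b) ^ 2 / (4 * L * t) := by positivity
        linarith
    simp only [inner_sub_right, inner_sub_left] at *
    linarith
  linarith

end Outer

/-! ### Projections onto the feasible set and the orthant; primal and dual steps. -/

section Projections

theorem IsProjection.inner_le_zero {n : ℕ} {X : Set (Vec n)} (hX : Convex ℝ X) {u p : Vec n}
    (hp : IsProjection X u p) {z : Vec n} (hz : z ∈ X) : inner ℝ (u - p) (z - p) ≤ 0 := by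
  refine (norm_eq_iInf_iff_real_inner_le_zero hX hp.1).1 ?_ z hz
  have : Nonempty X := ⟨⟨p, hp.1⟩⟩
  refine le_antisymm (le_ciInf fun w => hp.2 w w.2) (ciInf_le ⟨0, ?_⟩ (⟨p, hp.1⟩ : X))
  rintro _ ⟨w, rfl⟩
  exact norm_nonneg _

theorem IsProjection.norm_sub_le {n : ℕ} {X : Set (Vec n)} (hX : Convex ℝ X) {u u' p p' : Vec n}
    (hp : IsProjection X u p) (hp' : IsProjection X u' p') : ‖p - p'‖ ≤ ‖u - u'‖ := by
  have h1 := hp.inner_le_zero hX hp'.1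
  have h2 := hp'.inner_le_zero hX hp.1
  have h3 := real_inner_le_norm (u - u') (p - p')
  have h4 : ‖p - p'‖ ^ 2 ≤ inner ℝ (u - u') (p - p') := by
    rw [← real_inner_self_eq_norm_sq]
    simp only [inner_sub_left, inner_sub_right, real_inner_comm] at *
    linarith [real_inner_comm p p']
  by_contra hlt
  push Not at hlt
  nlinarith [norm_nonneg (u - u'), norm_nonneg (p - p')]

theorem IsProjection.mem_closure {n : ℕ} {X : Set (Vec n)} {u p : Vec n} (hp : IsProjection X u p) :
    IsProjection (closure X) u p := by
  refine ⟨subset_closure hp.1, fun z hz => ?_⟩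
  have : closure X ⊆ {z | ‖u - p‖ ≤ ‖u - z‖} :=
    closure_minimal (fun z hz => hp.2 z hz)
      (isClosed_le continuous_const (continuous_const.sub continuous_id).norm)
  exact this hz

/-- The projection onto a convex set, where it exists, is the restriction of a continuous map. -/
theorem exists_continuous_projection {n : ℕ} {X : Set (Vec n)} (hX : Convex ℝ X)
    (hne : X.Nonempty) :
    ∃ π : Vec n → Vec n, Continuous π ∧ ∀ u p, IsProjection X u p → p = π u := by
  -- X need not be closed. The projection onto its closure always exists, is nonexpansive, and
  -- agrees with the projection onto X wherever the latter exists.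
  have hex : ∀ u, ∃ p, IsProjection (closure X) u p := by
    intro u
    obtain ⟨p, hp, he⟩ := exists_norm_eq_iInf_of_complete_convex hne.closure
      isClosed_closure.isComplete hX.closure u
    refine ⟨p, hp, fun z hz => ?_⟩
    rw [he]
    exact ciInf_le ⟨0, by rintro _ ⟨w, rfl⟩; exact norm_nonneg _⟩ (⟨z, hz⟩ : closure X)
  choose π hπ using hex
  refine ⟨π, ?_, fun u p hp => ?_⟩
  · have : LipschitzWith 1 π := LipschitzWith.of_dist_le_mul fun u v => by
      simpa [dist_eq_norm] using (hπ u).norm_sub_le hX.closure (hπ v)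
    exact this.continuous
  · have := hp.mem_closure.norm_sub_le hX.closure (hπ u)
    rwa [sub_self, norm_zero, norm_le_zero_iff, sub_eq_zero] at this

/-- The variational inequality of the projection tested at z, plus the three-point identity. The
term in ‖x' - x‖ is kept for later absorption by the negative square. -/
theorem IsProjection.prox_inequality {n : ℕ} {X : Set (Vec n)} (hX : Convex ℝ X) {η : ℝ}
    (hη : 0 < η) {x v x' z : Vec n} (hp : IsProjection X (x - η⁻¹ • v) x') (hz : z ∈ X) :
    inner ℝ v (x - z) + η / 2 * ‖x' - z‖ ^ 2 ≤
      η / 2 * ‖x - z‖ ^ 2 + ‖v‖ * ‖x' - x‖ - η / 2 * ‖x' - x‖ ^ 2 := by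
  have h1 := mul_le_mul_of_nonneg_left (hp.inner_le_zero hX hz) hη.le
  have h2 := real_inner_le_norm v (x - x')
  rw [norm_sub_rev] at h2
  have e1 : x - η⁻¹ • v - x' = -(x' - x) - η⁻¹ • v := by abel
  have e2 : x - z = (x' - z) - (x' - x) := by abel
  have e3 : z - x' = -(x' - z) := by abel
  have e4 : x - x' = -(x' - x) := by abel
  rw [e4, inner_neg_right] at h2
  rw [e1, e3, inner_neg_right, inner_sub_left, inner_neg_left, real_inner_smul_left] at h1
  rw [e2, norm_sub_sq_real (x' - z) (x' - x), inner_sub_right]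
  have e5 : η * -(-inner ℝ (x' - x) (x' - z) - η⁻¹ * inner ℝ v (x' - z))
      = η * inner ℝ (x' - x) (x' - z) + inner ℝ v (x' - z) := by field_simp; ring
  rw [e5, real_inner_comm] at h1
  linarith

@[simp] theorem vecPos_apply {m : ℕ} (u : Vec m) (j : Fin m) : vecPos u j = max (u j) 0 := rfl

theorem vecPos_mem {m : ℕ} (u : Vec m) : vecPos u ∈ nonnegOrthant m := fun _ => le_max_right _ _

theorem vec_inner_eq_sum {m : ℕ} (u v : Vec m) : inner ℝ u v = ∑ j, u j * v j := by
  simp [PiLp.inner_apply, mul_comm]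

theorem inner_nonpos_of_nonneg {m : ℕ} {l v : Vec m} (hl : l ∈ nonnegOrthant m)
    (hv : ∀ j, v j ≤ 0) : inner ℝ l v ≤ 0 := by
  rw [vec_inner_eq_sum]
  exact Finset.sum_nonpos fun j _ => mul_nonpos_of_nonneg_of_nonpos (hl j) (hv j)

theorem inner_mono_of_nonneg {m : ℕ} {l v w : Vec m} (hl : l ∈ nonnegOrthant m)
    (hv : ∀ j, v j ≤ w j) : inner ℝ l v ≤ inner ℝ l w := by
  rw [vec_inner_eq_sum, vec_inner_eq_sum]
  exact Finset.sum_le_sum fun j _ => mul_le_mul_of_nonneg_left (hv j) (hl j)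

theorem inner_sub_vecPos_le {m : ℕ} (u : Vec m) {l : Vec m} (hl : l ∈ nonnegOrthant m) :
    inner ℝ (u - vecPos u) (l - vecPos u) ≤ 0 := by
  rw [vec_inner_eq_sum]
  refine Finset.sum_nonpos fun j _ => ?_
  have := hl j
  simp only [PiLp.sub_apply, vecPos_apply]
  rcases le_total (u j) 0 with h | h
  · rw [max_eq_right h]; nlinarith
  · rw [max_eq_left h]; simp

theorem norm_vecPos_sq {m : ℕ} (u : Vec m) : inner ℝ (vecPos u) u = ‖vecPos u‖ ^ 2 := by
  rw [← real_inner_self_eq_norm_sq, vec_inner_eq_sum, vec_inner_eq_sum]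
  refine Finset.sum_congr rfl fun j _ => ?_
  simp only [vecPos_apply]
  rcases le_total (u j) 0 with h | h
  · rw [max_eq_right h]; simp
  · rw [max_eq_left h]

theorem norm_vecPos_le {m : ℕ} (u : Vec m) : ‖vecPos u‖ ≤ ‖u‖ := by
  have h := real_inner_le_norm (vecPos u) u
  rw [norm_vecPos_sq] at h
  by_contra hlt
  push Not at hlt
  nlinarith [norm_nonneg u]

theorem continuous_vecPos {m : ℕ} : Continuous (vecPos : Vec m → Vec m) := by
  refine (PiLp.continuous_toLp 2 _).comp (continuous_pi fun j => ?_)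
  exact (EuclideanSpace.proj j : Vec m →L[ℝ] ℝ).continuous.max continuous_const

/-- Dual ascent with step 1/(2s). The squares measure gh against gs, the constraint value at the
saddle point, so that only the oscillation of g over X matters and not its size. -/
theorem dual_telescope {m : ℕ} {s : ℝ} (hs : 0 < s) (gh lam : ℕ → Vec m) {gs l : Vec m}
    (hgs : ∀ j, gs j ≤ 0) (hl : l ∈ nonnegOrthant m) (h0 : lam 0 = 0) (T : ℕ)
    (hlam : ∀ t < T, lam (t + 1) = vecPos (lam t + (2 * s)⁻¹ • gh t)) :
    ∑ t ∈ Finset.range T, inner ℝ l (gh t) + s * ‖lam T - l‖ ^ 2 ≤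
      ∑ t ∈ Finset.range T, (inner ℝ (lam t) (gh t) + ‖gh t - gs‖ ^ 2 / (4 * s))
        + s * ‖l‖ ^ 2 := by
  have hnn : lam T ∈ nonnegOrthant m := by
    rcases T with _ | T
    · rw [h0]; intro j; simp
    · rw [hlam T (by omega)]; exact vecPos_mem _
  -- The induction carries the term ⟨λ_T, gs⟩, which is nonpositive at the end: its increments
  -- ⟨λ_{t+1} - λ_t, gs⟩ turn gh into gh - gs in Young's inequality.
  suffices H : ∑ t ∈ Finset.range T, inner ℝ l (gh t) + s * ‖lam T - l‖ ^ 2 ≤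
      ∑ t ∈ Finset.range T, (inner ℝ (lam t) (gh t) + ‖gh t - gs‖ ^ 2 / (4 * s))
        + s * ‖l‖ ^ 2 + inner ℝ (lam T) gs from
    H.trans (by linarith [inner_nonpos_of_nonneg hnn hgs])
  clear hnn
  induction T with
  | zero => simp [h0]
  | succ T ih =>
    have ih := ih fun t ht => hlam t (by omega)
    rw [Finset.sum_range_succ, Finset.sum_range_succ]
    have h1 := mul_le_mul_of_nonneg_left
      (inner_sub_vecPos_le (lam T + (2 * s)⁻¹ • gh T) hl) (by positivity : 0 ≤ 2 * s)
    rw [← hlam T (by omega)] at h1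
    set a := lam T
    set b := lam (T + 1)
    have e1 : a + (2 * s)⁻¹ • gh T - b = (2 * s)⁻¹ • gh T - (b - a) := by abel
    have e2 : l - b = -(b - l) := by abel
    have e3 : a - l = (b - l) - (b - a) := by abel
    rw [e1, e2, inner_neg_right, inner_sub_left, real_inner_smul_left] at h1
    rw [e3, norm_sub_sq_real] at ih
    have e5 : 2 * s * -((2 * s)⁻¹ * inner ℝ (gh T) (b - l) - inner ℝ (b - a) (b - l))
        = 2 * s * inner ℝ (b - l) (b - a) - inner ℝ (gh T) (b - l) := by
      rw [real_inner_comm (b - l) (b - a)]; field_simp; ring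
    rw [e5] at h1
    have h2 : 0 ≤ ‖(2 * s) • (b - a) - (gh T - gs)‖ ^ 2 / (4 * s) := by positivity
    have e6 : ‖(2 * s) • (b - a) - (gh T - gs)‖ ^ 2 / (4 * s)
        = s * ‖b - a‖ ^ 2 - inner ℝ (b - a) (gh T - gs) + ‖gh T - gs‖ ^ 2 / (4 * s) := by
      rw [norm_sub_sq_real, norm_smul, real_inner_smul_left, Real.norm_of_nonneg (by positivity)]
      field_simp; ring
    rw [e6] at h2
    have e7 : inner ℝ (gh T) (b - l) = inner ℝ (b - a) (gh T) + inner ℝ a (gh T)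
        - inner ℝ l (gh T) := by
      rw [← inner_add_left, ← inner_sub_left, real_inner_comm]; congr 1; abel
    rw [e7] at h1
    rw [inner_sub_right, inner_sub_left b a gs] at h2
    linarith

end Projections

/-! ### Matrix subgradients and the Lipschitz bounds they give. -/

section Subdifferential

variable {n k : ℕ}

theorem mat_apply_eq_sum (A : Mat n k) (l : Vec k) :
    A l = ∑ j, l j • A (EuclideanSpace.single j 1) := by
  have h : l = ∑ j, l j • EuclideanSpace.single j (1 : ℝ) := by
    ext i
    simp [Finset.sum_apply, Pi.single_apply]
  conv_lhs => rw [h]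
  simp [map_sum]

theorem inner_mat_apply (A : Mat n k) (l : Vec k) (d : Vec n) :
    inner ℝ (A l) d = ∑ j, l j * inner ℝ (A (EuclideanSpace.single j 1)) d := by
  rw [mat_apply_eq_sum, sum_inner]
  simp [real_inner_smul_left]

theorem inner_subgradient_le {h : Vec n → Vec k} {x : Vec n} {A : Mat n k}
    (hA : A ∈ subdifferential h x) {l : Vec k} (hl : l ∈ nonnegOrthant k) (z : Vec n) :
    inner ℝ l (h x) + inner ℝ (A l) (z - x) ≤ inner ℝ l (h z) := by
  rw [inner_mat_apply, vec_inner_eq_sum, vec_inner_eq_sum, ← Finset.sum_add_distrib]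
  refine Finset.sum_le_sum fun j _ => ?_
  have := mul_le_mul_of_nonneg_left (hA j z) (hl j)
  linarith

/-- Testing the subgradient inequality at x + d and x - d forces equality, so the multiplier l may
have any sign. -/
theorem inner_subgradient_affine {h : Vec n → Vec k} (B : Vec n →ᵃ[ℝ] Vec k) (hB : ∀ x, h x = B x)
    {x : Vec n} {A : Mat n k} (hA : A ∈ subdifferential h x) (l : Vec k) (z : Vec n) :
    inner ℝ l (h x) + inner ℝ (A l) (z - x) = inner ℝ l (h z) := by
  rw [inner_mat_apply, vec_inner_eq_sum, vec_inner_eq_sum, ← Finset.sum_add_distrib]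
  refine Finset.sum_congr rfl fun j _ => ?_
  have key : ∀ d, B (x + d) j = B x j + B.linear d j := fun d => by
    have := B.map_vadd x d
    rw [vadd_eq_add, vadd_eq_add, add_comm d x] at this
    rw [this, PiLp.add_apply, add_comm]
  have h1 := hA j (x + (z - x))
  have h2 := hA j (x + -(z - x))
  rw [hB, hB, key, add_sub_cancel_left] at h1 h2
  rw [map_neg, inner_neg_right, PiLp.neg_apply] at h2
  have h3 := key (z - x)
  rw [add_sub_cancel] at h3
  rw [hB, hB, h3]
  have : inner ℝ (A (EuclideanSpace.single j 1)) (z - x) = B.linear (z - x) j := by linarith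
  rw [this]; ring

theorem inner_sub_le_of_subgradient {h : Vec n → Vec k} {z : Vec n} {A : Mat n k} {l : Vec k}
    {x : Vec n} (hA : inner ℝ l (h z) + inner ℝ (A l) (x - z) ≤ inner ℝ l (h x)) {C c : ℝ}
    (hC : ‖A‖ ≤ C) (hc : ‖l‖ ≤ c) : inner ℝ l (h z) ≤ inner ℝ l (h x) + C * c * ‖z - x‖ := by
  have h1 := abs_le.1 (abs_real_inner_le_norm (A l) (x - z))
  have h2 : ‖A l‖ ≤ C * c := (A.le_opNorm l).trans
    (mul_le_mul hC hc (norm_nonneg _) ((norm_nonneg _).trans hC))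
  rw [norm_sub_rev x z] at h1
  have h3 := mul_le_mul_of_nonneg_right h2 (norm_nonneg (z - x))
  linarith [h1.1]

/-- Pairing with the positive part of h z - h x as multiplier bounds that part using a subgradient
at z; the negative part needs one at x. The two parts are orthogonal, whence the factor 2. -/
theorem norm_sub_sq_le_of_subgradients {h : Vec n → Vec k} {C : ℝ} {x z : Vec n}
    (hx : ∃ A ∈ subdifferential h x, ‖A‖ ≤ C) (hz : ∃ A ∈ subdifferential h z, ‖A‖ ≤ C) :
    ‖h z - h x‖ ^ 2 ≤ 2 * C ^ 2 * ‖z - x‖ ^ 2 := by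
  have aux : ∀ x z : Vec n, (∃ A ∈ subdifferential h z, ‖A‖ ≤ C) →
      ‖vecPos (h z - h x)‖ ^ 2 ≤ C ^ 2 * ‖z - x‖ ^ 2 := by
    rintro x z ⟨A, hA, hC⟩
    have h1 := inner_sub_le_of_subgradient
      (inner_subgradient_le hA (vecPos_mem (h z - h x)) x) hC le_rfl
    have h2 := norm_vecPos_sq (h z - h x)
    rw [inner_sub_right] at h2
    have h0 : 0 ≤ C := (norm_nonneg _).trans hC
    have h3 : ‖vecPos (h z - h x)‖ ≤ C * ‖z - x‖ := by
      by_contra hlt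
      push Not at hlt
      have : 0 ≤ C * ‖z - x‖ := by positivity
      nlinarith
    rw [← mul_pow]
    exact pow_le_pow_left₀ (norm_nonneg _) h3 2
  have h1 := aux x z hz
  have h2 := aux z x hx
  have h3 : ‖h z - h x‖ ^ 2 = ‖vecPos (h z - h x)‖ ^ 2 + ‖vecPos (h x - h z)‖ ^ 2 := by
    simp only [EuclideanSpace.norm_sq_eq, ← Finset.sum_add_distrib]
    refine Finset.sum_congr rfl fun j _ => ?_
    simp only [vecPos_apply, PiLp.sub_apply, Real.norm_eq_abs, sq_abs]
    rcases le_total (h z j) (h x j) with hj | hj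
    · rw [max_eq_right (by linarith), max_eq_left (by linarith)]; ring
    · rw [max_eq_left (by linarith), max_eq_right (by linarith)]; ring
  rw [norm_sub_rev x z] at h2
  linarith

theorem continuous_of_convex_components {h : Vec n → Vec k}
    (hh : ∀ j, ConvexOn ℝ Set.univ fun x => h x j) : Continuous h :=
  (PiLp.continuous_toLp 2 (fun _ : Fin k => ℝ)).comp
    (continuous_pi fun j => (hh j).locallyLipschitz.continuous)

end Subdifferential

/-! ### First moments from second moments. -/

section Moments

variable {α E : Type*} [MeasurableSpace α] [NormedAddCommGroup E] [NormedSpace ℝ E]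
  {ν : Measure α} [IsProbabilityMeasure ν]

omit [NormedSpace ℝ E] in
-- Nonnegativity of the variance of ‖f‖.
theorem integral_norm_le_of_moment {f : α → E} (hf : MemLp f 2 ν) {c : ℝ} (hc : 0 ≤ c)
    (h : ∫ a, ‖f a‖ ^ 2 ∂ν ≤ c ^ 2) : ∫ a, ‖f a‖ ∂ν ≤ c := by
  have h1 := variance_nonneg (fun a => ‖f a‖) ν
  rw [variance_eq_sub hf.norm] at h1
  simp only [Pi.pow_apply] at h1
  exact (abs_le_of_sq_le_sq' (by linarith) hc).2

theorem norm_integral_le_of_moment {f : α → E} (hf : MemLp f 2 ν) {c : ℝ} (hc : 0 ≤ c)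
    (h : ∫ a, ‖f a‖ ^ 2 ∂ν ≤ c ^ 2) : ‖∫ a, f a ∂ν‖ ≤ c :=
  (norm_integral_le_integral_norm f).trans (integral_norm_le_of_moment hf hc h)

end Moments

/-! ### Feasibility and nonnegative gap at a saddle point. -/

section Saddle

variable {dx dy m : ℕ} {Ξ₁ Ξ₂ Z : Type*} {P : Problem dx dy m Ξ₁ Ξ₂ Z} {xs : Vec dx} {ls : Vec m}

/-- Raising the j-th coordinate of `ls` by 1 changes the Lagrangian at `xs` by the j-th constraint
value, and `ls` maximizes there. -/
theorem Problem.IsSaddle.feasible (h : P.IsSaddle xs ls) (j : Fin m) : P.g xs j ≤ 0 := by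
  have h1 := (h.saddle xs h.primal_mem (ls + EuclideanSpace.single j 1) (fun i => ?_)).1
  · simp only [Problem.lagrangian, ← vec_inner_eq_sum, inner_add_left] at h1
    rw [EuclideanSpace.inner_single_left] at h1
    simp only [map_one, one_mul] at h1
    linarith
  · have := h.dual_mem i
    simp only [PiLp.add_apply, PiLp.single_apply]
    split_ifs <;> linarith

theorem Problem.IsSaddle.gap_nonneg (h : P.IsSaddle xs ls) {x : Vec dx} (hx : x ∈ P.X) :
    0 ≤ P.F x - P.F xs + inner ℝ ls (P.g x) := by
  have h1 := (h.saddle x hx ls h.dual_mem).2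
  have h2 := (h.saddle x hx 0 (fun j => by simp)).1
  simp only [Problem.lagrangian, ← vec_inner_eq_sum, inner_zero_left] at h1 h2
  linarith

end Saddle

/-! ### The Lagrangian gap along one sample path. -/

section ProblemFacts

variable {dx dy m : ℕ} {Ξ₁ Ξ₂ Z : Type*}
  [MeasurableSpace Ξ₁] [MeasurableSpace Ξ₂] [MeasurableSpace Z]
  {P₁ : Measure Ξ₁} [IsProbabilityMeasure P₁] {P₂ : Measure Ξ₂} [IsProbabilityMeasure P₂]
  {PZ : Measure Z} [IsProbabilityMeasure PZ]
  {P : Problem dx dy m Ξ₁ Ξ₂ Z} {xs : Vec dx} {ls : Vec m}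
  {Cf₁ Cf₂ σf₁ σf₂ Lf₁ DX Cg σg : ℝ}

theorem Problem.ObjectiveAssumption.norm_gradient_le
    (hobj : P.ObjectiveAssumption P₁ P₂ xs Cf₁ Cf₂ σf₁ σf₂ Lf₁ DX) (y : Vec dy) :
    ‖gradient P.f₁ y‖ ≤ Cf₁ := by
  rw [← hobj.f₁grad_mean]
  exact norm_integral_le_of_moment (hobj.f₁grad_memLp y) hobj.Cf₁_pos.le (hobj.f₁grad_moment y)

theorem Problem.ObjectiveAssumption.norm_subgradient_le
    (hobj : P.ObjectiveAssumption P₁ P₂ xs Cf₁ Cf₂ σf₁ σf₂ Lf₁ DX) {x : Vec dx} (hx : x ∈ P.X) :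
    ‖∫ ξ, P.f₂sub x ξ ∂P₂‖ ≤ Cf₂ :=
  norm_integral_le_of_moment (hobj.f₂sub_memLp x hx) hobj.Cf₂_pos.le (hobj.f₂sub_moment x hx)

theorem Problem.ConstraintAssumption.norm_subgradient_le
    (hcon : P.ConstraintAssumption PZ Cg σg) {x : Vec dx} (hx : x ∈ P.X) :
    ‖∫ ζ, P.gsub x ζ ∂PZ‖ ≤ Cg :=
  norm_integral_le_of_moment (hcon.gsub_memLp x hx) hcon.Cg_pos.le (hcon.gsub_moment x hx)

/-- Along the gradients of the outer function the inner function is convex. -/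
theorem Problem.ObjectiveAssumption.inner_gradient_subgradient_le
    (hobj : P.ObjectiveAssumption P₁ P₂ xs Cf₁ Cf₂ σf₁ σf₂ Lf₁ DX) (hmono : P.MonotoneAssumption)
    {x : Vec dx} (hx : x ∈ P.X) (y : Vec dy) (z : Vec dx) :
    inner ℝ (gradient P.f₁ y) (P.f₂ x)
      + inner ℝ ((∫ ξ, P.f₂sub x ξ ∂P₂) (gradient P.f₁ y)) (z - x)
      ≤ inner ℝ (gradient P.f₁ y) (P.f₂ z) := by
  by_cases h : ∃ A : Vec dx →ᵃ[ℝ] Vec dy, ∀ x, P.f₂ x = A x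
  · obtain ⟨A, hA⟩ := h
    exact (inner_subgradient_affine A hA (hobj.f₂sub_mean x hx) _ z).le
  · exact inner_subgradient_le (hobj.f₂sub_mean x hx) (fun j => hmono h y j) z

theorem Problem.ObjectiveAssumption.cocoercive
    (hobj : P.ObjectiveAssumption P₁ P₂ xs Cf₁ Cf₂ σf₁ σf₂ Lf₁ DX) (y z : Vec dy) :
    P.f₁ y + inner ℝ (gradient P.f₁ y) (z - y)
      + 1 / (2 * Lf₁) * ‖gradient P.f₁ y - gradient P.f₁ z‖ ^ 2 ≤ P.f₁ z :=
  cocoercive_inequality hobj.Lf₁_pos hobj.convex_f₁ hobj.differentiable_f₁ hobj.smooth_f₁ y z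

theorem sum_sub_average {n : ℕ} (z : ℕ → Vec n) {T : ℕ} (hT : 0 < T) :
    ∑ t ∈ Finset.range T, (z t - (T : ℝ)⁻¹ • ∑ t ∈ Finset.range T, z t) = 0 := by
  have : (T : ℝ) ≠ 0 := by positivity
  rw [Finset.sum_sub_distrib, Finset.sum_const, Finset.card_range, ← Nat.cast_smul_eq_nsmul ℝ,
    smul_smul, mul_inv_cancel₀ this, one_smul, sub_self]

theorem average_mem {n : ℕ} {X : Set (Vec n)} (hX : Convex ℝ X) (z : ℕ → Vec n) {T : ℕ}
    (hT : 0 < T) (hz : ∀ t < T, z t ∈ X) : (T : ℝ)⁻¹ • ∑ t ∈ Finset.range T, z t ∈ X := by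
  rw [Finset.smul_sum]
  refine hX.sum_mem (fun _ _ => by positivity) ?_ fun t ht => hz t (Finset.mem_range.1 ht)
  rw [Finset.sum_const, Finset.card_range, nsmul_eq_mul]
  exact mul_inv_cancel₀ (by positivity)

/-- A real-valued Jensen inequality from an affine minorant that is exact at the average. -/
theorem card_mul_le_sum_of_affine_minorant {n : ℕ} {φ : Vec n → ℝ} (z : ℕ → Vec n) {T : ℕ}
    (hT : 0 < T) {v : Vec n}
    (hv : ∀ w, φ ((T : ℝ)⁻¹ • ∑ t ∈ Finset.range T, z t)
      + inner ℝ v (w - (T : ℝ)⁻¹ • ∑ t ∈ Finset.range T, z t) ≤ φ w) :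
    T * φ ((T : ℝ)⁻¹ • ∑ t ∈ Finset.range T, z t) ≤ ∑ t ∈ Finset.range T, φ (z t) := by
  have h := Finset.sum_le_sum fun t (_ : t ∈ Finset.range T) => hv (z t)
  rw [Finset.sum_add_distrib, ← inner_sum, sum_sub_average z hT, inner_zero_right, add_zero,
    Finset.sum_const, Finset.card_range, nsmul_eq_mul] at h
  exact h

/-- The bound on the Lagrangian gap at the average of the iterates, along a single sample path. -/
theorem pathwise_gap (hobj : P.ObjectiveAssumption P₁ P₂ xs Cf₁ Cf₂ σf₁ σf₂ Lf₁ DX)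
    (hcon : P.ConstraintAssumption PZ Cg σg) (hmono : P.MonotoneAssumption)
    (hsaddle : P.IsSaddle xs ls) {s : ℝ} (hs : 0 < s) {T : ℕ} (hT : 0 < T)
    (x Gf Gg : ℕ → Vec dx) (y h : ℕ → Vec dy) (lam gh : ℕ → Vec m)
    (hx : ∀ t ≤ T, x t ∈ P.X) (hlam0 : lam 0 = 0)
    (hy : ∀ t < T, y (t + 1) = (1 + (t : ℝ) / 2)⁻¹ • (h t + ((t : ℝ) / 2) • y t))
    (hxs : ∀ t < T, IsProjection P.X (x t - (15 * s / 2)⁻¹ • (Gf t + Gg t)) (x (t + 1)))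
    (hlam : ∀ t < T, lam (t + 1) = vecPos (lam t + (2 * s)⁻¹ • gh t))
    {l : Vec m} (hl : l ∈ nonnegOrthant m) {c : ℝ} (hc : ‖l‖ ≤ c) :
    T * (P.F ((T : ℝ)⁻¹ • ∑ t ∈ Finset.range T, x (t + 1)) - P.F xs
        + inner ℝ l (P.g ((T : ℝ)⁻¹ • ∑ t ∈ Finset.range T, x (t + 1))))
      + s * ‖lam T - l‖ ^ 2 ≤
    ∑ t ∈ Finset.range T,
      ((inner ℝ (gradient P.f₁ (y (t + 1))) (P.f₂ (x t) - P.f₂ xs) - inner ℝ (Gf t) (x t - xs))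
        + (inner ℝ (lam t) (gh t) - inner ℝ (Gg t) (x t - xs))
        - inner ℝ (gradient P.f₁ (y t)) (P.f₂ (x t) - h t)
        + Lf₁ / t * ‖P.f₂ (x t) - h t‖ ^ 2
        + (if t = 0 then 2 * Cf₁ * ‖P.f₂ (x t) - h t‖ else 0)
        + 4 / (15 * s) * (Cf₁ ^ 2 * Cf₂ ^ 2 + Cg ^ 2 * c ^ 2 + ‖Gf t‖ ^ 2 + ‖Gg t‖ ^ 2)
        + ‖gh t - P.g xs‖ ^ 2 / (4 * s))
      + Cf₁ * ‖∑ t ∈ Finset.range T, (P.f₂ (x t) - h t)‖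
      + c * ‖∑ t ∈ Finset.range T, (P.g (x t) - gh t)‖
      + 15 * s / 4 * ‖x 0 - xs‖ ^ 2 + s * c ^ 2 := by
  set xb := (T : ℝ)⁻¹ • ∑ t ∈ Finset.range T, x (t + 1) with hxb
  have hxbm : xb ∈ P.X := average_mem hobj.convex_X (fun t => x (t + 1)) hT fun t ht => hx _ ht
  have o1 := averaging_inequality hobj.Lf₁_pos hobj.cocoercive hobj.norm_gradient_le
    (fun t => P.f₂ (x t)) h y (P.f₂ xb) (P.f₂ xs) T hy
  -- Jensen's inequality for the inner function weighted by ∇f₁(f₂(x̄)). This weighted function is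
  -- convex: either f₂ is affine or the weights are nonnegative.
  have o2 : T * P.F xb ≤ ∑ t ∈ Finset.range T,
      (P.f₁ (P.f₂ xb) + inner ℝ (gradient P.f₁ (P.f₂ xb)) (P.f₂ (x (t + 1)) - P.f₂ xb)) := by
    have := card_mul_le_sum_of_affine_minorant (φ := fun w => inner ℝ (gradient P.f₁ (P.f₂ xb)) (P.f₂ w))
      (fun t => x (t + 1)) hT (hobj.inner_gradient_subgradient_le hmono hxbm (P.f₂ xb))
    simp only [inner_sub_right, Finset.sum_add_distrib, Finset.sum_sub_distrib, Finset.sum_const,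
      Finset.card_range, nsmul_eq_mul]
    rw [← hxb] at this
    unfold Problem.F
    linarith
  -- The average involves x (t + 1), but the oracle is queried at x t; a subgradient at x (t + 1)
  -- bounds the change by the step length. The same is done for the constraints in `d3`.
  have o3 : ∀ t ∈ Finset.range T,
      P.f₁ (P.f₂ xb) + inner ℝ (gradient P.f₁ (P.f₂ xb)) (P.f₂ (x (t + 1)) - P.f₂ xb) ≤
      P.f₁ (P.f₂ xb) + inner ℝ (gradient P.f₁ (P.f₂ xb)) (P.f₂ (x t) - P.f₂ xb)
        + Cf₂ * Cf₁ * ‖x (t + 1) - x t‖ := by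
    intro t ht
    have ht := Finset.mem_range.1 ht
    have := inner_sub_le_of_subgradient
      (hobj.inner_gradient_subgradient_le hmono (hx (t + 1) ht) (P.f₂ xb) (x t))
      (hobj.norm_subgradient_le (hx (t + 1) ht)) (hobj.norm_gradient_le (P.f₂ xb))
    simp only [inner_sub_right]
    linarith
  have o4 := o2.trans (Finset.sum_le_sum o3)
  rw [Finset.sum_add_distrib] at o4
  have d1 := dual_telescope hs gh lam hsaddle.feasible hl hlam0 T hlam
  have d2 : T * inner ℝ l (P.g xb) ≤ ∑ t ∈ Finset.range T, inner ℝ l (P.g (x (t + 1))) :=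
    card_mul_le_sum_of_affine_minorant (φ := fun w => inner ℝ l (P.g w))
      (fun t => x (t + 1)) hT (inner_subgradient_le (hcon.gsub_mean xb hxbm) hl)
  have d3 : ∀ t ∈ Finset.range T, inner ℝ l (P.g (x (t + 1))) ≤
      (inner ℝ l (gh t) + inner ℝ l (P.g (x t) - gh t)) + Cg * c * ‖x (t + 1) - x t‖ := by
    intro t ht
    have ht := Finset.mem_range.1 ht
    have := inner_sub_le_of_subgradient
      (inner_subgradient_le (hcon.gsub_mean _ (hx (t + 1) ht)) hl (x t))
      (hcon.norm_subgradient_le (hx (t + 1) ht)) hc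
    simp only [inner_sub_right]
    linarith
  have d4 := d2.trans (Finset.sum_le_sum d3)
  have d5 : ∑ t ∈ Finset.range T, inner ℝ l (P.g (x t) - gh t)
      ≤ c * ‖∑ t ∈ Finset.range T, (P.g (x t) - gh t)‖ := by
    rw [← inner_sum]
    exact (real_inner_le_norm _ _).trans (mul_le_mul_of_nonneg_right hc (norm_nonneg _))
  have d6 : s * ‖l‖ ^ 2 ≤ s * c ^ 2 :=
    mul_le_mul_of_nonneg_left (pow_le_pow_left₀ (norm_nonneg _) hc 2) hs.le
  have p1 : ∀ t ∈ Finset.range T,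
      (inner ℝ (Gf t) (x t - xs) + inner ℝ (Gg t) (x t - xs))
        + (15 * s / 4 * ‖x (t + 1) - xs‖ ^ 2 - 15 * s / 4 * ‖x t - xs‖ ^ 2)
        + (Cf₂ * Cf₁ * ‖x (t + 1) - x t‖ + Cg * c * ‖x (t + 1) - x t‖) ≤
      4 / (15 * s) * (Cf₁ ^ 2 * Cf₂ ^ 2 + Cg ^ 2 * c ^ 2 + ‖Gf t‖ ^ 2 + ‖Gg t‖ ^ 2) := by
    intro t ht
    have h1 := (hxs t (Finset.mem_range.1 ht)).prox_inequality hobj.convex_X (by positivity)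
      hsaddle.primal_mem
    rw [inner_add_left] at h1
    have h2 := mul_le_mul_of_nonneg_right (norm_add_le (Gf t) (Gg t)) (norm_nonneg (x (t + 1) - x t))
    set D := ‖x (t + 1) - x t‖
    set a := Cf₂ * Cf₁
    set b := Cg * c
    set u := ‖Gf t‖
    set v := ‖Gg t‖
    -- Half of η = 15s/2 is the coefficient of D². Maximizing over D gives (a + b + u + v)² / (15s),
    -- and Cauchy–Schwarz on the four summands gives the factor 4.
    have h3 : (a + b + u + v) * D - 15 * s / 4 * D ^ 2 ≤
        4 / (15 * s) * (a ^ 2 + b ^ 2 + u ^ 2 + v ^ 2) := by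
      have e : 4 / (15 * s) * (a ^ 2 + b ^ 2 + u ^ 2 + v ^ 2)
          - ((a + b + u + v) * D - 15 * s / 4 * D ^ 2) =
          1 / (15 * s) * ((15 * s / 2 * D - (a + b + u + v)) ^ 2 + (a - b) ^ 2 + (a - u) ^ 2
            + (a - v) ^ 2 + (b - u) ^ 2 + (b - v) ^ 2 + (u - v) ^ 2) := by
        field_simp; ring
      have : 0 ≤ 1 / (15 * s) * ((15 * s / 2 * D - (a + b + u + v)) ^ 2 + (a - b) ^ 2
            + (a - u) ^ 2 + (a - v) ^ 2 + (b - u) ^ 2 + (b - v) ^ 2 + (u - v) ^ 2) := by positivity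
      linarith
    have e4 : Cf₁ ^ 2 * Cf₂ ^ 2 + Cg ^ 2 * c ^ 2 = a ^ 2 + b ^ 2 := by simp only [a, b]; ring
    rw [e4]
    linarith
  have p2 := Finset.sum_le_sum p1
  rw [Finset.sum_add_distrib, Finset.sum_add_distrib, Finset.sum_range_sub
    (fun t => 15 * s / 4 * ‖x t - xs‖ ^ 2)] at p2
  have p3 : 0 ≤ 15 * s / 4 * ‖x T - xs‖ ^ 2 := by positivity
  simp only [Finset.sum_add_distrib, Finset.sum_sub_distrib, Finset.sum_const, Finset.card_range,
    nsmul_eq_mul, inner_sub_right] at *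
  unfold Problem.F at *
  linarith

end ProblemFacts

/-! ### Integrating out an independent sample. -/

section Freezing

variable {Ω α β : Type*} [MeasurableSpace Ω] [MeasurableSpace α] [MeasurableSpace β]
  {μ : Measure Ω} [IsProbabilityMeasure μ] {ν : Measure β} [IsProbabilityMeasure ν]
  {U : Ω → α} {V : Ω → β}

theorem map_prodMk_eq_prod (hU : Measurable U) (hV : MeasurePreserving V μ ν)
    (hUV : IndepFun U V μ) : μ.map (fun ω => (U ω, V ω)) = (μ.map U).prod ν := by
  rw [(indepFun_iff_map_prod_eq_prod_map_map hU.aemeasurable hV.measurable.aemeasurable).1 hUV,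
    hV.map_eq]

/-- Integrating out an independent argument of a nonnegative function. -/
theorem integrable_integral_le_of_indepFun (hU : Measurable U) (hV : MeasurePreserving V μ ν)
    (hUV : IndepFun U V μ) {Φ : α × β → ℝ} (hΦ : Measurable Φ) (h0 : ∀ p, 0 ≤ Φ p) {c : Ω → ℝ}
    (hint : ∀ ω, Integrable (fun v => Φ (U ω, v)) ν) (hc : ∀ ω, ∫ v, Φ (U ω, v) ∂ν ≤ c ω)
    (hcint : Integrable c μ) :
    Integrable (fun ω => Φ (U ω, V ω)) μ ∧ ∫ ω, Φ (U ω, V ω) ∂μ ≤ ∫ ω, c ω ∂μ := by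
  have hm : Measurable fun ω => Φ (U ω, V ω) := hΦ.comp (hU.prodMk hV.measurable)
  have hΦ' : Measurable fun p => ENNReal.ofReal (Φ p) := hΦ.ennreal_ofReal
  have hc0 : ∀ ω, 0 ≤ c ω := fun ω => (integral_nonneg fun v => h0 _).trans (hc ω)
  -- Integrability of the composite is part of the conclusion, so Tonelli is applied to the extended
  -- nonnegative integral first.
  have key : ∫⁻ ω, ENNReal.ofReal (Φ (U ω, V ω)) ∂μ ≤ ENNReal.ofReal (∫ ω, c ω ∂μ) := by
    have e1 : ∫⁻ ω, ENNReal.ofReal (Φ (U ω, V ω)) ∂μ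
        = ∫⁻ p, ENNReal.ofReal (Φ p) ∂(μ.map fun ω => (U ω, V ω)) :=
      (lintegral_map hΦ' (hU.prodMk hV.measurable)).symm
    rw [e1, map_prodMk_eq_prod hU hV hUV, lintegral_prod _ hΦ'.aemeasurable,
      lintegral_map hΦ'.lintegral_prod_right' hU,
      ofReal_integral_eq_lintegral_ofReal hcint (Filter.Eventually.of_forall hc0)]
    refine lintegral_mono fun ω => ?_
    rw [← ofReal_integral_eq_lintegral_ofReal (hint ω) (Filter.Eventually.of_forall fun v => h0 _)]
    exact ENNReal.ofReal_le_ofReal (hc ω)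
  refine ⟨⟨hm.aestronglyMeasurable, ?_⟩, ?_⟩
  · rw [hasFiniteIntegral_iff_ofReal (Filter.Eventually.of_forall fun ω => h0 _)]
    exact key.trans_lt ENNReal.ofReal_lt_top
  · rw [integral_eq_lintegral_of_nonneg_ae (Filter.Eventually.of_forall fun ω => h0 _)
      hm.aestronglyMeasurable]
    exact ENNReal.toReal_le_of_le_ofReal (integral_nonneg hc0) key

/-- Fubini for the joint law, which independence makes a product. In use, U is the history and V the
fresh sample. -/
theorem integral_of_indepFun (hU : Measurable U) (hV : MeasurePreserving V μ ν)
    (hUV : IndepFun U V μ) {Φ : α × β → ℝ} (hΦ : Measurable Φ)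
    (hint : Integrable (fun ω => Φ (U ω, V ω)) μ) :
    ∫ ω, Φ (U ω, V ω) ∂μ = ∫ ω, ∫ v, Φ (U ω, v) ∂ν ∂μ := by
  have hUVm := hU.prodMk hV.measurable
  have h1 : Integrable Φ ((μ.map U).prod ν) := by
    rw [← map_prodMk_eq_prod hU hV hUV]
    exact (integrable_map_measure hΦ.aestronglyMeasurable hUVm.aemeasurable).2 hint
  have e1 : ∫ ω, Φ (U ω, V ω) ∂μ = ∫ p, Φ p ∂(μ.map fun ω => (U ω, V ω)) :=
    (integral_map hUVm.aemeasurable hΦ.aestronglyMeasurable).symm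
  rw [e1, map_prodMk_eq_prod hU hV hUV, integral_prod _ h1]
  exact integral_map hU.aemeasurable
    hΦ.stronglyMeasurable.integral_prod_right'.aestronglyMeasurable

end Freezing

/-! ### Oracles queried at random points independent of the sample. -/

section Oracles

variable {Ω β : Type*} [MeasurableSpace Ω] [MeasurableSpace β]
  {μ : Measure Ω} [IsProbabilityMeasure μ] {ν : Measure β} [IsProbabilityMeasure ν]
  {V : Ω → β} {n k : ℕ}

theorem memLp_integral_sq_le_of_indepFun {α E : Type*} [MeasurableSpace α] [NormedAddCommGroup E]
    [MeasurableSpace E] [BorelSpace E] [SecondCountableTopology E] {U : Ω → α}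
    (hU : Measurable U) (hV : MeasurePreserving V μ ν) (hUV : IndepFun U V μ) {Φ : α × β → E}
    (hΦ : Measurable Φ) {c : Ω → ℝ} (hint : ∀ ω, MemLp (fun v => Φ (U ω, v)) 2 ν)
    (hc : ∀ ω, ∫ v, ‖Φ (U ω, v)‖ ^ 2 ∂ν ≤ c ω) (hcint : Integrable c μ) :
    MemLp (fun ω => Φ (U ω, V ω)) 2 μ ∧ ∫ ω, ‖Φ (U ω, V ω)‖ ^ 2 ∂μ ≤ ∫ ω, c ω ∂μ := by
  have h := integrable_integral_le_of_indepFun hU hV hUV (Φ := fun p => ‖Φ p‖ ^ 2)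
    (hΦ.norm.pow_const 2) (fun _ => by positivity) (fun ω => (hint ω).integrable_norm_pow') hc hcint
  refine ⟨(memLp_two_iff_integrable_sq_norm ?_).2 h.1, h.2⟩
  exact (hΦ.comp (hU.prodMk hV.measurable)).aestronglyMeasurable

theorem memLp_inner {E : Type*} [NormedAddCommGroup E] [InnerProductSpace ℝ E] {f g : Ω → E}
    (hf : MemLp f 2 μ) (hg : MemLp g 2 μ) : Integrable (fun ω => inner ℝ (f ω) (g ω)) μ := by
  refine (hf.norm.integrable_mul hg.norm).mono (hf.1.inner hg.1) ?_
  refine Filter.Eventually.of_forall fun ω => ?_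
  simpa [Real.norm_eq_abs] using abs_real_inner_le_norm (f ω) (g ω)

/-- An unbiased value oracle queried at an independent point: the noise has the right variance. -/
theorem value_noise {X : Set (Vec n)}
    {val : Vec n → β → Vec k} (hval : Measurable fun p : Vec n × β => val p.1 p.2)
    {q : Vec n → Vec k} (hq : Measurable q) {σ : ℝ}
    (hmem : ∀ x ∈ X, MemLp (val x) 2 ν)
    (hvar : ∀ x ∈ X, ∫ v, ‖val x v - q x‖ ^ 2 ∂ν ≤ σ ^ 2)
    {x : Ω → Vec n} (hx : Measurable x) (hxX : ∀ ω, x ω ∈ X) (hV : MeasurePreserving V μ ν)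
    (hxV : IndepFun x V μ) :
    MemLp (fun ω => q (x ω) - val (x ω) (V ω)) 2 μ ∧
      ∫ ω, ‖q (x ω) - val (x ω) (V ω)‖ ^ 2 ∂μ ≤ σ ^ 2 := by
  have h := memLp_integral_sq_le_of_indepFun hx hV hxV (Φ := fun p => q p.1 - val p.1 p.2)
    ((hq.comp measurable_fst).sub hval) (c := fun _ => σ ^ 2)
    (fun ω => (memLp_const (q (x ω))).sub (hmem _ (hxX ω)))
    (fun ω => by simpa only [norm_sub_rev] using hvar _ (hxX ω)) (integrable_const _)
  simpa using h

/-- The noise of an unbiased value oracle is orthogonal to what is independent of the sample. -/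
theorem integral_inner_noise_eq_zero {X : Set (Vec n)}
    {val : Vec n → β → Vec k} (hval : Measurable fun p : Vec n × β => val p.1 p.2)
    {q : Vec n → Vec k} (hq : Measurable q)
    (hmem : ∀ x ∈ X, MemLp (val x) 2 ν) (hmean : ∀ x ∈ X, ∫ v, val x v ∂ν = q x)
    {x : Ω → Vec n} (hx : Measurable x) (hxX : ∀ ω, x ω ∈ X) (hV : MeasurePreserving V μ ν)
    {w : Ω → Vec k} (hw : Measurable w) (hxwV : IndepFun (fun ω => (x ω, w ω)) V μ)
    (hw2 : MemLp w 2 μ) (hnoise : MemLp (fun ω => q (x ω) - val (x ω) (V ω)) 2 μ) :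
    ∫ ω, inner ℝ (w ω) (q (x ω) - val (x ω) (V ω)) ∂μ = 0 := by
  have h := integral_of_indepFun (hx.prodMk hw) hV hxwV
    (Φ := fun p => inner ℝ p.1.2 (q p.1.1 - val p.1.1 p.2))
    ((measurable_snd.comp measurable_fst).inner
      ((hq.comp (measurable_fst.comp measurable_fst)).sub
        (hval.comp ((measurable_fst.comp measurable_fst).prodMk measurable_snd))))
    (memLp_inner hw2 hnoise)
  rw [h]
  refine integral_eq_zero_of_ae (Filter.Eventually.of_forall fun ω => ?_)
  have hi := (hmem _ (hxX ω)).integrable one_le_two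
  simp only
  have hd : Integrable (fun v => q (x ω) - val (x ω) v) ν := (integrable_const _).sub hi
  rw [integral_inner hd, integral_sub (integrable_const _) hi, hmean _ (hxX ω)]
  simp

theorem measurable_clm_apply {α : Type*} [MeasurableSpace α] {A : α → Mat n k} {w : α → Vec k}
    (hA : Measurable A) (hw : Measurable w) : Measurable fun a => A a (w a) :=
  isBoundedBilinearMap_apply.continuous.measurable.comp (hA.prodMk hw)

/-- A matrix oracle applied to a vector that is independent of the sample. -/
theorem matrix_oracle {X : Set (Vec n)}
    {sub : Vec n → β → Mat n k} (hsub : Measurable fun p : Vec n × β => sub p.1 p.2) {C : ℝ}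
    (hmem : ∀ x ∈ X, MemLp (sub x) 2 ν) (hmom : ∀ x ∈ X, ∫ v, ‖sub x v‖ ^ 2 ∂ν ≤ C ^ 2)
    {x : Ω → Vec n} (hx : Measurable x) (hxX : ∀ ω, x ω ∈ X) (hV : MeasurePreserving V μ ν)
    {w : Ω → Vec k} (hw : Measurable w) (hxwV : IndepFun (fun ω => (x ω, w ω)) V μ)
    (hw2 : MemLp w 2 μ) :
    MemLp (fun ω => sub (x ω) (V ω) (w ω)) 2 μ ∧
      ∫ ω, ‖sub (x ω) (V ω) (w ω)‖ ^ 2 ∂μ ≤ C ^ 2 * ∫ ω, ‖w ω‖ ^ 2 ∂μ := by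
  have hm1 : Measurable fun p : (Vec n × Vec k) × β => sub p.1.1 p.2 :=
    hsub.comp ((measurable_fst.comp measurable_fst).prodMk measurable_snd)
  have h := memLp_integral_sq_le_of_indepFun (hx.prodMk hw) hV hxwV
    (Φ := fun p => sub p.1.1 p.2 p.1.2)
    (measurable_clm_apply hm1 (measurable_snd.comp measurable_fst))
    (c := fun ω => C ^ 2 * ‖w ω‖ ^ 2) (fun ω => ?_) (fun ω => ?_)
    (hw2.integrable_norm_pow'.const_mul _)
  · rwa [integral_const_mul] at h
  · exact ((ContinuousLinearMap.apply ℝ (Vec n) (w ω)).comp_memLp' (hmem _ (hxX ω)))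
  · calc ∫ v, ‖sub (x ω) v (w ω)‖ ^ 2 ∂ν ≤ ∫ v, ‖sub (x ω) v‖ ^ 2 * ‖w ω‖ ^ 2 ∂ν := by
          refine integral_mono
            ((ContinuousLinearMap.apply ℝ (Vec n) (w ω)).comp_memLp'
              (hmem _ (hxX ω))).integrable_norm_pow'
            (Integrable.mul_const (hmem _ (hxX ω)).integrable_norm_pow' _) fun v => ?_
          simp only
          rw [← mul_pow]
          exact pow_le_pow_left₀ (norm_nonneg _) ((sub (x ω) v).le_opNorm _) 2
      _ ≤ C ^ 2 * ‖w ω‖ ^ 2 := by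
          rw [integral_mul_const]
          exact mul_le_mul_of_nonneg_right (hmom _ (hxX ω)) (by positivity)

theorem integral_inner_matrix_oracle {X : Set (Vec n)}
    {sub : Vec n → β → Mat n k} (hsub : Measurable fun p : Vec n × β => sub p.1 p.2)
    (hmem : ∀ x ∈ X, MemLp (sub x) 2 ν)
    {x : Ω → Vec n} (hx : Measurable x) (hxX : ∀ ω, x ω ∈ X) (hV : MeasurePreserving V μ ν)
    {w : Ω → Vec k} (hw : Measurable w) (hxwV : IndepFun (fun ω => (x ω, w ω)) V μ)
    {xs : Vec n} (hxs : MemLp (fun ω => x ω - xs) 2 μ)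
    (h2 : MemLp (fun ω => sub (x ω) (V ω) (w ω)) 2 μ) :
    ∫ ω, inner ℝ (sub (x ω) (V ω) (w ω)) (x ω - xs) ∂μ =
      ∫ ω, inner ℝ ((∫ v, sub (x ω) v ∂ν) (w ω)) (x ω - xs) ∂μ := by
  have hm1 : Measurable fun p : (Vec n × Vec k) × β => sub p.1.1 p.2 :=
    hsub.comp ((measurable_fst.comp measurable_fst).prodMk measurable_snd)
  have h := integral_of_indepFun (hx.prodMk hw) hV hxwV
    (Φ := fun p => inner ℝ (sub p.1.1 p.2 p.1.2) (p.1.1 - xs))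
    ((measurable_clm_apply hm1 (measurable_snd.comp measurable_fst)).inner
      ((measurable_fst.comp measurable_fst).sub_const xs))
    (memLp_inner h2 hxs)
  rw [h]
  refine integral_congr_ae (Filter.Eventually.of_forall fun ω => ?_)
  have hi := (hmem _ (hxX ω)).integrable one_le_two
  simp only
  have e : ∀ v, inner ℝ (sub (x ω) v (w ω)) (x ω - xs) =
      ((innerSL ℝ (x ω - xs)).comp (ContinuousLinearMap.apply ℝ (Vec n) (w ω))) (sub (x ω) v) :=
    fun v => real_inner_comm (x ω - xs) (sub (x ω) v (w ω))
  simp_rw [e]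
  rw [ContinuousLinearMap.integral_comp_comm _ hi]
  exact real_inner_comm ((∫ v, sub (x ω) v ∂ν) (w ω)) (x ω - xs)

/-- Sums of orthogonal noise grow like the square root. -/
theorem integral_norm_sum_le {E : Type*} [NormedAddCommGroup E] [InnerProductSpace ℝ E]
    {d : ℕ → Ω → E} {σ : ℝ} (hσ : 0 ≤ σ) (T : ℕ) (hd : ∀ t < T, MemLp (d t) 2 μ)
    (hvar : ∀ t < T, ∫ ω, ‖d t ω‖ ^ 2 ∂μ ≤ σ ^ 2)
    (horth : ∀ t < T, ∫ ω, inner ℝ (∑ i ∈ Finset.range t, d i ω) (d t ω) ∂μ = 0) :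
    Integrable (fun ω => ‖∑ t ∈ Finset.range T, d t ω‖) μ ∧
      ∫ ω, ‖∑ t ∈ Finset.range T, d t ω‖ ∂μ ≤ √T * σ := by
  have hS : ∀ t ≤ T, MemLp (fun ω => ∑ i ∈ Finset.range t, d i ω) 2 μ := fun t ht =>
    memLp_finsetSum _ fun i hi => hd i ((Finset.mem_range.1 hi).trans_le ht)
  -- Pythagoras: each new term is orthogonal to the partial sum, so variances add. The first moment
  -- then follows from the second.
  have key : ∀ t ≤ T, ∫ ω, ‖∑ i ∈ Finset.range t, d i ω‖ ^ 2 ∂μ ≤ t * σ ^ 2 := by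
    intro t
    induction t with
    | zero => simp
    | succ t ih =>
      intro ht
      have i1 : Integrable (fun ω => ‖∑ i ∈ Finset.range t, d i ω‖ ^ 2) μ :=
        (hS t (by omega)).integrable_norm_pow'
      have i2 : Integrable (fun ω => 2 * inner ℝ (∑ i ∈ Finset.range t, d i ω) (d t ω)) μ :=
        (memLp_inner (hS t (by omega)) (hd t ht)).const_mul 2
      have i3 : Integrable (fun ω => ‖d t ω‖ ^ 2) μ := (hd t ht).integrable_norm_pow'
      simp_rw [Finset.sum_range_succ, norm_add_sq_real]
      rw [integral_add (by exact i1.add i2) i3, integral_add i1 i2, integral_const_mul,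
        horth t ht]
      push_cast
      linarith [ih (by omega), hvar t ht]
  refine ⟨((hS T le_rfl).integrable one_le_two).norm,
    integral_norm_le_of_moment (hS T le_rfl) (by positivity) ?_⟩
  rw [mul_pow, Real.sq_sqrt (Nat.cast_nonneg T)]
  exact key T le_rfl

end Oracles

/-! ### Measurability of the iterates. -/

section Measurability

variable {dx dy m : ℕ} {Ξ₁ Ξ₂ Z Ω : Type*}
  [MeasurableSpace Ξ₁] [MeasurableSpace Ξ₂] [MeasurableSpace Z]
  {P : Problem dx dy m Ξ₁ Ξ₂ Z} {N : ℕ} {τ α η : ℕ → ℝ} {x₀ : Vec dx} {lam₀ : Vec m}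
  {ξ₁ : ℕ → Ω → Ξ₁} {ξ₂ : ℕ → Fin 2 → Ω → Ξ₂} {ζ : ℕ → Fin 2 → Ω → Z}
  {x : ℕ → Ω → Vec dx} {y : ℕ → Ω → Vec dy} {lam : ℕ → Ω → Vec m}

theorem Problem.IsECSCGD.mem (h : P.IsECSCGD N τ α η x₀ lam₀ ξ₁ ξ₂ ζ x y lam) {t : ℕ} (ht : t ≤ N)
    (ω : Ω) : x t ω ∈ P.X := by
  rcases t with _ | t
  · rw [h.x_zero]; exact h.x₀_mem
  · exact (h.x_step t ht ω).1

theorem Problem.IsECSCGD.lam_mem (h : P.IsECSCGD N τ α η x₀ lam₀ ξ₁ ξ₂ ζ x y lam) {t : ℕ}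
    (ht : t ≤ N) (ω : Ω) : lam t ω ∈ nonnegOrthant m := by
  rcases t with _ | t
  · rw [h.lam_zero]; exact h.lam₀_mem
  · rw [h.lam_step t ht ω]; exact vecPos_mem _

theorem Problem.IsECSCGD.measurable_y_succ {mΩ : MeasurableSpace Ω}
    (h : P.IsECSCGD N τ α η x₀ lam₀ ξ₁ ξ₂ ζ x y lam) (hP : P.MeasurableOracle) {t : ℕ} (ht : t < N)
    (hx : Measurable (x t)) (hy : Measurable (y t)) (hξ : Measurable (ξ₂ t 1)) :
    Measurable (y (t + 1)) := by
  have e : y (t + 1) = fun ω => (1 + τ t)⁻¹ • (P.f₂val (x t ω) (ξ₂ t 1 ω) + τ t • y t ω) :=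
    funext (h.y_step t ht)
  rw [e]
  have h1 : Measurable fun ω => P.f₂val (x t ω) (ξ₂ t 1 ω) := hP.f₂val.comp (hx.prodMk hξ)
  fun_prop

/-- The σ-algebra on Ω is arbitrary, so that it can be the one generated by the earlier samples;
this is how independence of the history from a fresh sample is obtained. -/
theorem Problem.IsECSCGD.measurable_iterates {mΩ : MeasurableSpace Ω}
    (h : P.IsECSCGD N τ α η x₀ lam₀ ξ₁ ξ₂ ζ x y lam) (hP : P.MeasurableOracle)
    (hX : Convex ℝ P.X) {t : ℕ} (ht : t ≤ N)
    (hξ₁ : ∀ i < t, Measurable (ξ₁ i)) (hξ₂ : ∀ i < t, ∀ j, Measurable (ξ₂ i j))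
    (hζ : ∀ i < t, ∀ j, Measurable (ζ i j)) :
    Measurable (x t) ∧ Measurable (y t) ∧ Measurable (lam t) := by
  induction t with
  | zero =>
    refine ⟨?_, ?_, ?_⟩
    · rw [funext h.x_zero]; exact measurable_const
    · rw [funext h.y_zero]; exact measurable_const
    · rw [funext h.lam_zero]; exact measurable_const
  | succ t ih =>
    obtain ⟨hx, hy, hl⟩ := ih (by omega) (fun i hi => hξ₁ i (by omega))
      (fun i hi => hξ₂ i (by omega)) (fun i hi => hζ i (by omega))
    have hy' := h.measurable_y_succ hP ht hx hy (hξ₂ t (by omega) 1)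
    obtain ⟨π, hπ, hπe⟩ := exists_continuous_projection hX ⟨_, h.x₀_mem⟩
    refine ⟨?_, hy', ?_⟩
    · rw [funext fun ω => hπe _ _ (h.x_step t ht ω)]
      have h1 := measurable_clm_apply (hP.f₂sub.comp (hx.prodMk (hξ₂ t (by omega) 0)))
        (hP.f₁grad.comp (hy'.prodMk (hξ₁ t (by omega))))
      have h2 := measurable_clm_apply (hP.gsub.comp (hx.prodMk (hζ t (by omega) 0))) hl
      exact hπ.measurable.comp (hx.sub ((h1.add h2).const_smul (η t)⁻¹))
    · rw [funext (h.lam_step t ht)]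
      have h1 : Measurable fun ω => P.gval (x t ω) (ζ t 1 ω) :=
        hP.gval.comp (hx.prodMk (hζ t (by omega) 1))
      exact continuous_vecPos.measurable.comp (hl.add (h1.const_smul (α t)⁻¹))

end Measurability

/-! ### σ-algebras of blocks of samples. -/

section Sigma

variable {Ξ₁ Ξ₂ Z Ω : Type*}
  [MeasurableSpace Ξ₁] [MeasurableSpace Ξ₂] [MeasurableSpace Z] [mΩ : MeasurableSpace Ω]
  {μ : Measure Ω} {P₁ : Measure Ξ₁} {P₂ : Measure Ξ₂} {PZ : Measure Z} {N : ℕ}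
  {ξ₁ : ℕ → Ω → Ξ₁} {ξ₂ : ℕ → Fin 2 → Ω → Ξ₂} {ζ : ℕ → Fin 2 → Ω → Z}

/-- The σ-algebra generated by the samples with indices in `S`. -/
@[reducible] def samplesSigma (ξ₁ : ℕ → Ω → Ξ₁) (ξ₂ : ℕ → Fin 2 → Ω → Ξ₂) (ζ : ℕ → Fin 2 → Ω → Z)
    (N : ℕ) (S : Set (Fin N × Query)) : MeasurableSpace Ω :=
  ⨆ q ∈ S, sampleSigma ξ₁ ξ₂ ζ q.1 q.2

/-- The indices of the samples drawn before iteration `t`. -/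
def before (N t : ℕ) : Set (Fin N × Query) := {q | q.1.1 < t}

theorem sampleSigma_le_samplesSigma {S : Set (Fin N × Query)} {t : ℕ} (ht : t < N) {q : Query}
    (hq : ((⟨t, ht⟩, q) : Fin N × Query) ∈ S) :
    sampleSigma ξ₁ ξ₂ ζ t q ≤ samplesSigma ξ₁ ξ₂ ζ N S :=
  le_iSup₂_of_le (f := fun (q : Fin N × Query) (_ : q ∈ S) => sampleSigma ξ₁ ξ₂ ζ q.1 q.2)
    (⟨t, ht⟩, q) hq le_rfl

theorem IndependentSamples.sampleSigma_le (h : IndependentSamples μ P₁ P₂ PZ N ξ₁ ξ₂ ζ) {t : ℕ}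
    (ht : t < N) (q : Query) : sampleSigma ξ₁ ξ₂ ζ t q ≤ mΩ := by
  cases q with
  | outer => exact (h.law_ξ₁ t ht).measurable.comap_le
  | inner i => exact (h.law_ξ₂ t ht i).measurable.comap_le
  | constr i => exact (h.law_ζ t ht i).measurable.comap_le

theorem IndependentSamples.samplesSigma_le (h : IndependentSamples μ P₁ P₂ PZ N ξ₁ ξ₂ ζ)
    (S : Set (Fin N × Query)) : samplesSigma ξ₁ ξ₂ ζ N S ≤ mΩ :=
  iSup₂_le fun q _ => h.sampleSigma_le q.1.2 q.2

/-- Disjoint blocks of an independent family are independent. Each later independence claim reduces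
to naming a block S that determines U and omits the fresh sample. -/
theorem IndependentSamples.indepFun (h : IndependentSamples μ P₁ P₂ PZ N ξ₁ ξ₂ ζ)
    {S : Set (Fin N × Query)} {t : ℕ} (ht : t < N) {q : Query}
    (hq : ((⟨t, ht⟩, q) : Fin N × Query) ∉ S) {α β : Type*} [MeasurableSpace α] [MeasurableSpace β]
    {U : Ω → α} {V : Ω → β} (hU : Measurable[samplesSigma ξ₁ ξ₂ ζ N S] U)
    (hV : Measurable[sampleSigma ξ₁ ξ₂ ζ t q] V) : IndepFun U V μ := by
  rw [IndepFun_iff_Indep]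
  have hind := indep_iSup_of_disjoint (fun q => h.sampleSigma_le q.1.2 q.2) h.indep
    (Set.disjoint_singleton_right.2 hq)
  refine indep_of_indep_of_le_left (indep_of_indep_of_le_right hind ?_) hU.comap_le
  refine hV.comap_le.trans (sampleSigma_le_samplesSigma ht (Set.mem_singleton _))

end Sigma

/-! ### Bookkeeping of integrability together with bounds on integrals. -/

section IntegralLE

variable {Ω : Type*} [MeasurableSpace Ω] {μ : Measure Ω}

/-- `f` is integrable, with integral at most `a`. -/
def IntegralLE (μ : Measure Ω) (f : Ω → ℝ) (a : ℝ) : Prop := Integrable f μ ∧ ∫ ω, f ω ∂μ ≤ a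

theorem IntegralLE.add {f g : Ω → ℝ} {a b : ℝ} (hf : IntegralLE μ f a) (hg : IntegralLE μ g b) :
    IntegralLE μ (fun ω => f ω + g ω) (a + b) :=
  ⟨hf.1.add hg.1, by rw [integral_add hf.1 hg.1]; exact add_le_add hf.2 hg.2⟩

theorem IntegralLE.const_mul {f : Ω → ℝ} {a c : ℝ} (hf : IntegralLE μ f a) (hc : 0 ≤ c) :
    IntegralLE μ (fun ω => c * f ω) (c * a) :=
  ⟨hf.1.const_mul c, by rw [integral_const_mul]; exact mul_le_mul_of_nonneg_left hf.2 hc⟩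

theorem IntegralLE.div_const {f : Ω → ℝ} {a c : ℝ} (hf : IntegralLE μ f a) (hc : 0 ≤ c) :
    IntegralLE μ (fun ω => f ω / c) (a / c) := by
  simpa only [div_eq_inv_mul] using hf.const_mul (inv_nonneg.2 hc)

theorem IntegralLE.const [IsProbabilityMeasure μ] (a : ℝ) : IntegralLE μ (fun _ => a) a :=
  ⟨integrable_const a, by simp⟩

theorem IntegralLE.sum {f : ℕ → Ω → ℝ} {a : ℕ → ℝ} {T : ℕ}
    (hf : ∀ t < T, IntegralLE μ (f t) (a t)) :
    IntegralLE μ (fun ω => ∑ t ∈ Finset.range T, f t ω) (∑ t ∈ Finset.range T, a t) := by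
  refine ⟨integrable_finsetSum _ fun t ht => (hf t (Finset.mem_range.1 ht)).1, ?_⟩
  rw [integral_finsetSum _ fun t ht => (hf t (Finset.mem_range.1 ht)).1]
  exact Finset.sum_le_sum fun t ht => (hf t (Finset.mem_range.1 ht)).2

end IntegralLE

/-- The data and hypotheses of a run of the algorithm with parameters `τ_t = t / 2`, `α_t = 2 s`
and `η_t = 15 s / 2`, started at `lam₀ = 0`. -/
structure Run {dx dy m : ℕ} {Ξ₁ Ξ₂ Z Ω : Type*}
    [MeasurableSpace Ξ₁] [MeasurableSpace Ξ₂] [MeasurableSpace Z] [MeasurableSpace Ω]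
    (μ : Measure Ω) (P₁ : Measure Ξ₁) (P₂ : Measure Ξ₂) (PZ : Measure Z)
    (P : Problem dx dy m Ξ₁ Ξ₂ Z) (xs : Vec dx) (ls : Vec m)
    (Cf₁ Cf₂ σf₁ σf₂ Lf₁ DX Cg σg s : ℝ) (N : ℕ)
    (ξ₁ : ℕ → Ω → Ξ₁) (ξ₂ : ℕ → Fin 2 → Ω → Ξ₂) (ζ : ℕ → Fin 2 → Ω → Z) (x₀ : Vec dx)
    (x : ℕ → Ω → Vec dx) (y : ℕ → Ω → Vec dy) (lam : ℕ → Ω → Vec m) : Prop where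
  oracle : P.MeasurableOracle
  saddle : P.IsSaddle xs ls
  obj : P.ObjectiveAssumption P₁ P₂ xs Cf₁ Cf₂ σf₁ σf₂ Lf₁ DX
  con : P.ConstraintAssumption PZ Cg σg
  mono : P.MonotoneAssumption
  samples : IndependentSamples μ P₁ P₂ PZ N ξ₁ ξ₂ ζ
  s_pos : 0 < s
  alg : P.IsECSCGD N (fun t => (t : ℝ) / 2) (fun _ => 2 * s) (fun _ => 15 * s / 2) x₀ 0 ξ₁ ξ₂ ζ
    x y lam

/-! ### Expectations within one iteration. -/

section Iteration

variable {dx dy m : ℕ} {Ξ₁ Ξ₂ Z Ω : Type*}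
  [MeasurableSpace Ξ₁] [MeasurableSpace Ξ₂] [MeasurableSpace Z] [MeasurableSpace Ω]
  {μ : Measure Ω} [IsProbabilityMeasure μ]
  {P₁ : Measure Ξ₁} [IsProbabilityMeasure P₁] {P₂ : Measure Ξ₂} [IsProbabilityMeasure P₂]
  {PZ : Measure Z} [IsProbabilityMeasure PZ]
  {P : Problem dx dy m Ξ₁ Ξ₂ Z} {xs : Vec dx} {ls : Vec m}
  {Cf₁ Cf₂ σf₁ σf₂ Lf₁ DX Cg σg s : ℝ} {N : ℕ}
  {ξ₁ : ℕ → Ω → Ξ₁} {ξ₂ : ℕ → Fin 2 → Ω → Ξ₂} {ζ : ℕ → Fin 2 → Ω → Z} {x₀ : Vec dx}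
  {x : ℕ → Ω → Vec dx} {y : ℕ → Ω → Vec dy} {lam : ℕ → Ω → Vec m} {t : ℕ}

theorem measurable_ξ₁_samplesSigma {S : Set (Fin N × Query)} (ht : t < N)
    (hq : ((⟨t, ht⟩, Query.outer) : Fin N × Query) ∈ S) :
    Measurable[samplesSigma ξ₁ ξ₂ ζ N S] (ξ₁ t) :=
  (comap_measurable (ξ₁ t)).mono
    (sampleSigma_le_samplesSigma (ξ₁ := ξ₁) (ξ₂ := ξ₂) (ζ := ζ) ht hq) le_rfl

theorem measurable_ξ₂_samplesSigma {S : Set (Fin N × Query)} (ht : t < N) {i : Fin 2}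
    (hq : ((⟨t, ht⟩, Query.inner i) : Fin N × Query) ∈ S) :
    Measurable[samplesSigma ξ₁ ξ₂ ζ N S] (ξ₂ t i) :=
  (comap_measurable (ξ₂ t i)).mono
    (sampleSigma_le_samplesSigma (ξ₁ := ξ₁) (ξ₂ := ξ₂) (ζ := ζ) ht hq) le_rfl

theorem measurable_ζ_samplesSigma {S : Set (Fin N × Query)} (ht : t < N) {i : Fin 2}
    (hq : ((⟨t, ht⟩, Query.constr i) : Fin N × Query) ∈ S) :
    Measurable[samplesSigma ξ₁ ξ₂ ζ N S] (ζ t i) :=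
  (comap_measurable (ζ t i)).mono
    (sampleSigma_le_samplesSigma (ξ₁ := ξ₁) (ξ₂ := ξ₂) (ζ := ζ) ht hq) le_rfl

/-- The error of the inner value that is used in iteration `t`. -/
def Problem.innerNoise (P : Problem dx dy m Ξ₁ Ξ₂ Z) (ξ₂ : ℕ → Fin 2 → Ω → Ξ₂)
    (x : ℕ → Ω → Vec dx) (t : ℕ) (ω : Ω) : Vec dy := P.f₂ (x t ω) - P.f₂val (x t ω) (ξ₂ t 1 ω)

/-- The error of the constraint value that is used in iteration `t`. -/
def Problem.constrNoise (P : Problem dx dy m Ξ₁ Ξ₂ Z) (ζ : ℕ → Fin 2 → Ω → Z)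
    (x : ℕ → Ω → Vec dx) (t : ℕ) (ω : Ω) : Vec m := P.g (x t ω) - P.gval (x t ω) (ζ t 1 ω)

/-- The stochastic gradient of the objective. -/
def Problem.objStep (P : Problem dx dy m Ξ₁ Ξ₂ Z) (ξ₁ : ℕ → Ω → Ξ₁) (ξ₂ : ℕ → Fin 2 → Ω → Ξ₂)
    (x : ℕ → Ω → Vec dx) (y : ℕ → Ω → Vec dy) (t : ℕ) (ω : Ω) : Vec dx :=
  P.f₂sub (x t ω) (ξ₂ t 0 ω) (P.f₁grad (y (t + 1) ω) (ξ₁ t ω))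

/-- The stochastic gradient of the constraint part of the Lagrangian. -/
def Problem.constrStep (P : Problem dx dy m Ξ₁ Ξ₂ Z) (ζ : ℕ → Fin 2 → Ω → Z)
    (x : ℕ → Ω → Vec dx) (lam : ℕ → Ω → Vec m) (t : ℕ) (ω : Ω) : Vec dx :=
  P.gsub (x t ω) (ζ t 0 ω) (lam t ω)

theorem continuous_gradient_of_obj
    (hobj : P.ObjectiveAssumption P₁ P₂ xs Cf₁ Cf₂ σf₁ σf₂ Lf₁ DX) :
    Continuous (gradient P.f₁) := by
  have : LipschitzWith (Real.toNNReal Lf₁) (gradient P.f₁) :=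
    LipschitzWith.of_dist_le_mul fun y z => by
      rw [dist_eq_norm, dist_eq_norm, Real.coe_toNNReal _ hobj.Lf₁_pos.le]
      exact hobj.smooth_f₁ y z
  exact this.continuous

theorem exists_norm_le_of_continuous
    (hobj : P.ObjectiveAssumption P₁ P₂ xs Cf₁ Cf₂ σf₁ σf₂ Lf₁ DX) {E : Type*}
    [NormedAddCommGroup E] {φ : Vec dx → E} (hφ : Continuous φ) : ∃ B, ∀ z ∈ P.X, ‖φ z‖ ≤ B := by
  obtain ⟨B, hB⟩ := (isCompact_closedBall xs DX).exists_bound_of_continuousOn hφ.continuousOn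
  exact ⟨B, fun z hz => hB z (by rw [mem_closedBall_iff_norm]; exact hobj.bounded_X z hz)⟩

variable (r : Run μ P₁ P₂ PZ P xs ls Cf₁ Cf₂ σf₁ σf₂ Lf₁ DX Cg σg s N ξ₁ ξ₂ ζ x₀ x y lam)

include r

theorem Run.continuous_f₂ : Continuous P.f₂ := continuous_of_convex_components r.obj.convex_f₂

theorem Run.continuous_g : Continuous P.g := continuous_of_convex_components r.con.convex_g

theorem Run.continuous_gradient : Continuous (gradient P.f₁) := continuous_gradient_of_obj r.obj

theorem Run.continuous_F : Continuous P.F :=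
  r.obj.differentiable_f₁.continuous.comp r.continuous_f₂

theorem Run.measurable_before (ht : t ≤ N) {S : Set (Fin N × Query)} (hS : before N t ⊆ S) :
    Measurable[samplesSigma ξ₁ ξ₂ ζ N S] (x t) ∧ Measurable[samplesSigma ξ₁ ξ₂ ζ N S] (y t) ∧
      Measurable[samplesSigma ξ₁ ξ₂ ζ N S] (lam t) := by
  refine r.alg.measurable_iterates r.oracle r.obj.convex_X ht (fun i hi => ?_) (fun i hi j => ?_)
    (fun i hi j => ?_)
  · exact measurable_ξ₁_samplesSigma (hi.trans_le ht) (hS hi)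
  · exact measurable_ξ₂_samplesSigma (hi.trans_le ht) (hS hi)
  · exact measurable_ζ_samplesSigma (hi.trans_le ht) (hS hi)

theorem Run.measurable (ht : t ≤ N) : Measurable (x t) ∧ Measurable (y t) ∧ Measurable (lam t) := by
  obtain ⟨h1, h2, h3⟩ := r.measurable_before ht subset_rfl
  have := r.samples.samplesSigma_le (before N t)
  exact ⟨h1.mono this le_rfl, h2.mono this le_rfl, h3.mono this le_rfl⟩

theorem Run.memLp_comp (ht : t ≤ N) {E : Type*} [NormedAddCommGroup E]
    [MeasurableSpace E] [BorelSpace E] [SecondCountableTopology E] {φ : Vec dx → E}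
    (hφ : Continuous φ) : MemLp (fun ω => φ (x t ω)) 2 μ := by
  obtain ⟨B, hB⟩ := exists_norm_le_of_continuous r.obj hφ
  exact MemLp.of_bound (hφ.measurable.comp (r.measurable ht).1).aestronglyMeasurable B
    (Filter.Eventually.of_forall fun ω => hB _ (r.alg.mem ht ω))

theorem Run.memLp_sub (ht : t ≤ N) : MemLp (fun ω => x t ω - xs) 2 μ :=
  r.memLp_comp ht (continuous_id.sub continuous_const)

theorem Run.memLp_gradient {z : Ω → Vec dy} (hz : Measurable z) :
    MemLp (fun ω => gradient P.f₁ (z ω)) 2 μ :=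
  MemLp.of_bound (r.continuous_gradient.measurable.comp hz).aestronglyMeasurable Cf₁
    (Filter.Eventually.of_forall fun _ => r.obj.norm_gradient_le _)

theorem Run.indepFun_before (ht : t < N) {q : Query} {α β : Type*} [MeasurableSpace α]
    [MeasurableSpace β] {U : Ω → α} {V : Ω → β}
    (hU : Measurable[samplesSigma ξ₁ ξ₂ ζ N (before N t)] U)
    (hV : Measurable[sampleSigma ξ₁ ξ₂ ζ t q] V) : IndepFun U V μ :=
  r.samples.indepFun ht (by simp [before]) hU hV

/-! The error of the inner values. -/

theorem Run.measurable_innerNoise {i : ℕ} (hi : i < t) (ht : t ≤ N) :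
    Measurable[samplesSigma ξ₁ ξ₂ ζ N (before N t)] (P.innerNoise ξ₂ x i) := by
  have h1 := (r.measurable_before (t := i) (S := before N t) (by omega)
    (fun q (hq : q.1.1 < i) => hq.trans hi)).1
  exact (r.continuous_f₂.measurable.comp h1).sub
    (r.oracle.f₂val.comp (h1.prodMk (measurable_ξ₂_samplesSigma (hi.trans_le ht) hi)))

theorem Run.innerNoise_memLp (ht : t < N) : MemLp (P.innerNoise ξ₂ x t) 2 μ ∧
    ∫ ω, ‖P.innerNoise ξ₂ x t ω‖ ^ 2 ∂μ ≤ σf₂ ^ 2 :=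
  value_noise r.oracle.f₂val r.continuous_f₂.measurable r.obj.f₂val_memLp r.obj.f₂val_var
    (r.measurable ht.le).1 (r.alg.mem ht.le) (r.samples.law_ξ₂ t ht 1)
    (r.indepFun_before ht (q := Query.inner 1) (r.measurable_before ht.le subset_rfl).1
      (comap_measurable _))

theorem Run.integral_inner_innerNoise (ht : t < N) {w : Ω → Vec dy}
    (hw : Measurable[samplesSigma ξ₁ ξ₂ ζ N (before N t)] w) (hw2 : MemLp w 2 μ) :
    ∫ ω, inner ℝ (w ω) (P.innerNoise ξ₂ x t ω) ∂μ = 0 :=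
  integral_inner_noise_eq_zero r.oracle.f₂val r.continuous_f₂.measurable r.obj.f₂val_memLp
    r.obj.f₂val_mean (r.measurable ht.le).1 (r.alg.mem ht.le) (r.samples.law_ξ₂ t ht 1)
    (hw.mono (r.samples.samplesSigma_le _) le_rfl)
    (r.indepFun_before ht (q := Query.inner 1)
      ((r.measurable_before ht.le subset_rfl).1.prodMk hw) (comap_measurable _))
    hw2 (r.innerNoise_memLp ht).1

theorem Run.integral_norm_sum_innerNoise {T : ℕ} (hT : T ≤ N) :
    IntegralLE μ (fun ω => ‖∑ t ∈ Finset.range T, P.innerNoise ξ₂ x t ω‖) (√T * σf₂) := by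
  refine integral_norm_sum_le r.obj.σf₂_pos.le T
    (fun t ht => (r.innerNoise_memLp (ht.trans_le hT)).1)
    (fun t ht => (r.innerNoise_memLp (ht.trans_le hT)).2) fun t ht => ?_
  refine r.integral_inner_innerNoise (ht.trans_le hT) ?_ ?_
  · exact Finset.measurable_fun_sum _ fun i hi =>
      r.measurable_innerNoise (Finset.mem_range.1 hi) (by omega)
  · exact memLp_finsetSum _ fun i hi =>
      (r.innerNoise_memLp (by have := Finset.mem_range.1 hi; omega)).1

/-! The error of the constraint values. -/

theorem Run.measurable_constrNoise {i : ℕ} (hi : i < t) (ht : t ≤ N) :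
    Measurable[samplesSigma ξ₁ ξ₂ ζ N (before N t)] (P.constrNoise ζ x i) := by
  have h1 := (r.measurable_before (t := i) (S := before N t) (by omega)
    (fun q (hq : q.1.1 < i) => hq.trans hi)).1
  exact (r.continuous_g.measurable.comp h1).sub
    (r.oracle.gval.comp (h1.prodMk (measurable_ζ_samplesSigma (hi.trans_le ht) hi)))

theorem Run.constrNoise_memLp (ht : t < N) : MemLp (P.constrNoise ζ x t) 2 μ ∧
    ∫ ω, ‖P.constrNoise ζ x t ω‖ ^ 2 ∂μ ≤ σg ^ 2 :=
  value_noise r.oracle.gval r.continuous_g.measurable r.con.gval_memLp r.con.gval_var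
    (r.measurable ht.le).1 (r.alg.mem ht.le) (r.samples.law_ζ t ht 1)
    (r.indepFun_before ht (q := Query.constr 1) (r.measurable_before ht.le subset_rfl).1
      (comap_measurable _))

theorem Run.integral_inner_constrNoise (ht : t < N) {w : Ω → Vec m}
    (hw : Measurable[samplesSigma ξ₁ ξ₂ ζ N (before N t)] w) (hw2 : MemLp w 2 μ) :
    ∫ ω, inner ℝ (w ω) (P.constrNoise ζ x t ω) ∂μ = 0 :=
  integral_inner_noise_eq_zero r.oracle.gval r.continuous_g.measurable r.con.gval_memLp
    r.con.gval_mean (r.measurable ht.le).1 (r.alg.mem ht.le) (r.samples.law_ζ t ht 1)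
    (hw.mono (r.samples.samplesSigma_le _) le_rfl)
    (r.indepFun_before ht (q := Query.constr 1)
      ((r.measurable_before ht.le subset_rfl).1.prodMk hw) (comap_measurable _))
    hw2 (r.constrNoise_memLp ht).1

theorem Run.integral_norm_sum_constrNoise {T : ℕ} (hT : T ≤ N) :
    IntegralLE μ (fun ω => ‖∑ t ∈ Finset.range T, P.constrNoise ζ x t ω‖) (√T * σg) := by
  refine integral_norm_sum_le r.con.σg_pos.le T
    (fun t ht => (r.constrNoise_memLp (ht.trans_le hT)).1)
    (fun t ht => (r.constrNoise_memLp (ht.trans_le hT)).2) fun t ht => ?_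
  refine r.integral_inner_constrNoise (ht.trans_le hT) ?_ ?_
  · exact Finset.measurable_fun_sum _ fun i hi =>
      r.measurable_constrNoise (Finset.mem_range.1 hi) (by omega)
  · exact memLp_finsetSum _ fun i hi =>
      (r.constrNoise_memLp (by have := Finset.mem_range.1 hi; omega)).1

theorem Run.gval_eq (ω : Ω) :
    P.gval (x t ω) (ζ t 1 ω) = P.g (x t ω) - P.constrNoise ζ x t ω := by
  simp [Problem.constrNoise]

theorem Run.memLp_gval (ht : t < N) : MemLp (fun ω => P.gval (x t ω) (ζ t 1 ω)) 2 μ := by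
  simp_rw [r.gval_eq]
  exact (r.memLp_comp ht.le r.continuous_g).sub (r.constrNoise_memLp ht).1

theorem Run.memLp_lam (ht : t ≤ N) : MemLp (lam t) 2 μ := by
  induction t with
  | zero => rw [funext r.alg.lam_zero]; exact memLp_const _
  | succ t ih =>
    have h := (ih (by omega)).add ((r.memLp_gval ht).const_smul (2 * s)⁻¹)
    refine h.mono (r.measurable ht).2.2.aestronglyMeasurable
      (Filter.Eventually.of_forall fun ω => ?_)
    rw [r.alg.lam_step t ht ω]
    exact norm_vecPos_le _

theorem Run.integral_inner_lam_gval (ht : t < N) :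
    ∫ ω, inner ℝ (lam t ω) (P.gval (x t ω) (ζ t 1 ω)) ∂μ
      = ∫ ω, inner ℝ (lam t ω) (P.g (x t ω)) ∂μ := by
  simp_rw [r.gval_eq, inner_sub_right]
  rw [integral_sub (memLp_inner (r.memLp_lam ht.le) (r.memLp_comp ht.le r.continuous_g))
    (memLp_inner (r.memLp_lam ht.le) (r.constrNoise_memLp ht).1),
    r.integral_inner_constrNoise ht (r.measurable_before ht.le subset_rfl).2.2 (r.memLp_lam ht.le),
    sub_zero]

/-- Oscillation of g over X plus the variance of the sample; the cross term vanishes because x_t is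
determined before the noise. -/
theorem Run.integral_gval_sub_sq (ht : t < N) :
    IntegralLE μ (fun ω => ‖P.gval (x t ω) (ζ t 1 ω) - P.g xs‖ ^ 2)
      (2 * Cg ^ 2 * DX ^ 2 + σg ^ 2) := by
  have hc : Continuous fun z => P.g z - P.g xs := r.continuous_g.sub continuous_const
  have hm := r.memLp_comp ht.le hc
  have hn := r.constrNoise_memLp ht
  have e : ∀ ω, ‖P.gval (x t ω) (ζ t 1 ω) - P.g xs‖ ^ 2 =
      (‖P.g (x t ω) - P.g xs‖ ^ 2
        - 2 * inner ℝ (P.g (x t ω) - P.g xs) (P.constrNoise ζ x t ω))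
        + ‖P.constrNoise ζ x t ω‖ ^ 2 := fun ω => by
    rw [r.gval_eq, ← norm_sub_sq_real]; congr 2; abel
  simp_rw [e]
  have i1 : Integrable (fun ω => ‖P.g (x t ω) - P.g xs‖ ^ 2) μ := hm.integrable_norm_pow'
  have i2 : Integrable (fun ω => 2 * inner ℝ (P.g (x t ω) - P.g xs) (P.constrNoise ζ x t ω)) μ :=
    (memLp_inner hm hn.1).const_mul 2
  have i3 : Integrable (fun ω => ‖P.constrNoise ζ x t ω‖ ^ 2) μ := hn.1.integrable_norm_pow'
  refine ⟨(i1.sub i2).add i3, ?_⟩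
  rw [integral_add (by exact i1.sub i2) i3, integral_sub i1 i2, integral_const_mul,
    r.integral_inner_constrNoise ht (w := fun ω => P.g (x t ω) - P.g xs)
      (hc.measurable.comp (r.measurable_before ht.le subset_rfl).1) hm]
  have hsg : ∀ z ∈ P.X, ∃ A ∈ subdifferential P.g z, ‖A‖ ≤ Cg := fun z hz =>
    ⟨_, r.con.gsub_mean z hz, r.con.norm_subgradient_le hz⟩
  have h1 : ∫ ω, ‖P.g (x t ω) - P.g xs‖ ^ 2 ∂μ ≤ ∫ _, 2 * Cg ^ 2 * DX ^ 2 ∂μ := by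
    refine integral_mono i1 (integrable_const _) fun ω => ?_
    have hx := r.alg.mem ht.le ω
    refine (norm_sub_sq_le_of_subgradients (hsg _ r.saddle.primal_mem) (hsg _ hx)).trans ?_
    exact mul_le_mul_of_nonneg_left
      (pow_le_pow_left₀ (norm_nonneg _) (r.obj.bounded_X _ hx) 2) (by positivity)
  simp only [integral_const, probReal_univ, one_smul] at h1
  linarith [hn.2]

/-! The stochastic gradient of the constraint part. -/

theorem Run.constrStep_memLp (ht : t < N) : MemLp (P.constrStep ζ x lam t) 2 μ ∧
    ∫ ω, ‖P.constrStep ζ x lam t ω‖ ^ 2 ∂μ ≤ Cg ^ 2 * ∫ ω, ‖lam t ω‖ ^ 2 ∂μ := by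
  obtain ⟨hx, -, hl⟩ := r.measurable_before ht.le subset_rfl
  exact matrix_oracle r.oracle.gsub r.con.gsub_memLp r.con.gsub_moment (r.measurable ht.le).1
    (r.alg.mem ht.le) (r.samples.law_ζ t ht 0) (r.measurable ht.le).2.2
    (r.indepFun_before ht (q := Query.constr 0) (hx.prodMk hl) (comap_measurable _))
    (r.memLp_lam ht.le)

/-- Given the history, the sampled matrix averages to a subgradient A of g at x_t, and ⟨A λ_t, x_t -
x*⟩ ≥ ⟨λ_t, g(x_t) - g(x*)⟩ ≥ ⟨λ_t, g(x_t)⟩, since λ_t ≥ 0 and g(x*) ≤ 0. -/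
theorem Run.integral_constrStep (ht : t < N) :
    IntegralLE μ (fun ω => inner ℝ (lam t ω) (P.gval (x t ω) (ζ t 1 ω))
      - inner ℝ (P.constrStep ζ x lam t ω) (x t ω - xs)) 0 := by
  obtain ⟨hx, -, hl⟩ := r.measurable_before ht.le subset_rfl
  have i1 := memLp_inner (r.memLp_lam ht.le) (r.memLp_gval ht)
  have i2 := memLp_inner (r.constrStep_memLp ht).1 (r.memLp_sub ht.le)
  have i3 := memLp_inner (r.memLp_lam ht.le) (r.memLp_comp ht.le r.continuous_g)
  refine ⟨i1.sub i2, ?_⟩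
  rw [integral_sub i1 i2, r.integral_inner_lam_gval ht, sub_nonpos]
  have h := integral_inner_matrix_oracle r.oracle.gsub r.con.gsub_memLp (r.measurable ht.le).1
    (r.alg.mem ht.le) (r.samples.law_ζ t ht 0) (r.measurable ht.le).2.2
    (r.indepFun_before ht (q := Query.constr 0) (hx.prodMk hl) (comap_measurable _))
    (r.memLp_sub ht.le) (r.constrStep_memLp ht).1
  refine le_trans ?_ h.ge
  have hA : Measurable fun z => ∫ v, P.gsub z v ∂PZ :=
    r.oracle.gsub.stronglyMeasurable.integral_prod_right'.measurable
  refine integral_mono i3 ?_ fun ω => ?_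
  · refine memLp_inner (MemLp.of_le_mul (c := Cg) (r.memLp_lam ht.le)
      (measurable_clm_apply (hA.comp (r.measurable ht.le).1)
        (r.measurable ht.le).2.2).aestronglyMeasurable (Filter.Eventually.of_forall fun ω => ?_))
      (r.memLp_sub ht.le)
    exact ContinuousLinearMap.le_of_opNorm_le _
      (r.con.norm_subgradient_le (r.alg.mem ht.le ω)) _
  · have hxm := r.alg.mem ht.le ω
    have h1 := inner_subgradient_le (r.con.gsub_mean _ hxm) (r.alg.lam_mem ht.le ω) xs
    have h2 := inner_nonpos_of_nonneg (r.alg.lam_mem ht.le ω) r.saddle.feasible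
    rw [← neg_sub, inner_neg_right] at h1
    simp only
    linarith

/-! The stochastic gradient of the objective. -/

theorem Run.measurable_y_succ (ht : t < N) {S : Set (Fin N × Query)} (hS : before N t ⊆ S)
    (hq : ((⟨t, ht⟩, Query.inner 1) : Fin N × Query) ∈ S) :
    Measurable[samplesSigma ξ₁ ξ₂ ζ N S] (y (t + 1)) := by
  obtain ⟨hx, hy, -⟩ := r.measurable_before ht.le hS
  exact r.alg.measurable_y_succ r.oracle ht hx hy (measurable_ξ₂_samplesSigma ht hq)

theorem Run.outerGrad_memLp (ht : t < N) :
    MemLp (fun ω => P.f₁grad (y (t + 1) ω) (ξ₁ t ω)) 2 μ ∧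
      ∫ ω, ‖P.f₁grad (y (t + 1) ω) (ξ₁ t ω)‖ ^ 2 ∂μ ≤ Cf₁ ^ 2 := by
  have hind : IndepFun (y (t + 1)) (ξ₁ t) μ :=
    r.samples.indepFun (S := before N t ∪ {(⟨t, ht⟩, Query.inner 1)}) ht (q := Query.outer)
      (by simp [before]) (r.measurable_y_succ ht Set.subset_union_left (by simp))
      (comap_measurable _)
  have h := memLp_integral_sq_le_of_indepFun (r.measurable ht).2.1 (r.samples.law_ξ₁ t ht) hind
    r.oracle.f₁grad (fun ω => r.obj.f₁grad_memLp (y (t + 1) ω))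
    (c := fun _ => Cf₁ ^ 2) (fun ω => r.obj.f₁grad_moment _) (integrable_const _)
  simpa using h

/-- The vector fed to the inner subgradient uses two samples of the current iteration, one through
y_{t+1} and one through the outer gradient; both join the block, and the subgradient sample stays
outside. -/
theorem Run.indepFun_objStep (ht : t < N) :
    IndepFun (fun ω => (x t ω, P.f₁grad (y (t + 1) ω) (ξ₁ t ω))) (ξ₂ t 0) μ := by
  refine r.samples.indepFun
    (S := before N t ∪ {(⟨t, ht⟩, Query.inner 1), (⟨t, ht⟩, Query.outer)}) ht
    (q := Query.inner 0) (by simp [before]) ?_ (comap_measurable _)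
  exact (r.measurable_before ht.le Set.subset_union_left).1.prodMk (r.oracle.f₁grad.comp
    ((r.measurable_y_succ ht Set.subset_union_left (by simp)).prodMk
      (measurable_ξ₁_samplesSigma ht (by simp))))

theorem Run.measurable_outerGrad (ht : t < N) :
    Measurable (fun ω => P.f₁grad (y (t + 1) ω) (ξ₁ t ω)) :=
  r.oracle.f₁grad.comp ((r.measurable ht).2.1.prodMk (r.samples.law_ξ₁ t ht).measurable)

theorem Run.objStep_memLp (ht : t < N) : MemLp (P.objStep ξ₁ ξ₂ x y t) 2 μ ∧
    ∫ ω, ‖P.objStep ξ₁ ξ₂ x y t ω‖ ^ 2 ∂μ ≤ Cf₁ ^ 2 * Cf₂ ^ 2 := by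
  have h := matrix_oracle r.oracle.f₂sub r.obj.f₂sub_memLp r.obj.f₂sub_moment
    (r.measurable ht.le).1 (r.alg.mem ht.le) (r.samples.law_ξ₂ t ht 0)
    (r.measurable_outerGrad ht) (r.indepFun_objStep ht) (r.outerGrad_memLp ht).1
  refine ⟨h.1, h.2.trans ?_⟩
  rw [mul_comm]
  exact mul_le_mul_of_nonneg_right (r.outerGrad_memLp ht).2 (by positivity)

/-- The samples are integrated out in reverse order: first the inner subgradient sample, then the
outer one. This leaves a subgradient of f₂ applied to ∇f₁(y_{t+1}), to which the weighted convexity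
of f₂ applies. -/
theorem Run.integral_objStep (ht : t < N) :
    IntegralLE μ (fun ω => inner ℝ (gradient P.f₁ (y (t + 1) ω)) (P.f₂ (x t ω) - P.f₂ xs)
      - inner ℝ (P.objStep ξ₁ ξ₂ x y t ω) (x t ω - xs)) 0 := by
  obtain ⟨hx, -, -⟩ := r.measurable ht.le
  have hy := (r.measurable ht).2.1
  have i1 : Integrable (fun ω => inner ℝ (gradient P.f₁ (y (t + 1) ω)) (P.f₂ (x t ω) - P.f₂ xs)) μ :=
    memLp_inner (r.memLp_gradient hy)
      (r.memLp_comp ht.le (r.continuous_f₂.sub (continuous_const (y := P.f₂ xs))))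
  have i2 := memLp_inner (r.objStep_memLp ht).1 (r.memLp_sub ht.le)
  refine ⟨i1.sub i2, ?_⟩
  rw [integral_sub i1 i2, sub_nonpos]
  set A : Vec dx → Mat dx dy := fun z => ∫ v, P.f₂sub z v ∂P₂ with hAdef
  have hA : Measurable A := r.oracle.f₂sub.stronglyMeasurable.integral_prod_right'.measurable
  have hAle : ∀ ω, ‖A (x t ω)‖ ≤ Cf₂ := fun ω => r.obj.norm_subgradient_le (r.alg.mem ht.le ω)
  have hmem : ∀ w : Ω → Vec dy, MemLp w 2 μ → Measurable w → MemLp (fun ω => A (x t ω) (w ω)) 2 μ :=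
    fun w hw hwm => MemLp.of_le_mul (c := Cf₂) hw
      (measurable_clm_apply (hA.comp hx) hwm).aestronglyMeasurable
      (Filter.Eventually.of_forall fun ω => ContinuousLinearMap.le_of_opNorm_le _ (hAle ω) _)
  have h := integral_inner_matrix_oracle r.oracle.f₂sub r.obj.f₂sub_memLp hx
    (r.alg.mem ht.le) (r.samples.law_ξ₂ t ht 0) (r.measurable_outerGrad ht)
    (r.indepFun_objStep ht) (r.memLp_sub ht.le) (r.objStep_memLp ht).1
  have hind : IndepFun (fun ω => (x t ω, y (t + 1) ω)) (ξ₁ t) μ :=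
    r.samples.indepFun (S := before N t ∪ {(⟨t, ht⟩, Query.inner 1)}) ht (q := Query.outer)
      (by simp [before])
      ((r.measurable_before ht.le Set.subset_union_left).1.prodMk
        (r.measurable_y_succ ht Set.subset_union_left (by simp)))
      (comap_measurable _)
  have hmA : Measurable fun p : (Vec dx × Vec dy) × Ξ₁ => A p.1.1 :=
    hA.comp (measurable_fst.comp measurable_fst)
  have h' := integral_of_indepFun (hx.prodMk hy) (r.samples.law_ξ₁ t ht) hind
    (Φ := fun p => inner ℝ (A p.1.1 (P.f₁grad p.1.2 p.2)) (p.1.1 - xs))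
    ((measurable_clm_apply hmA (r.oracle.f₁grad.comp
      ((measurable_snd.comp measurable_fst).prodMk measurable_snd))).inner
      ((measurable_fst.comp measurable_fst).sub_const xs))
    (memLp_inner (hmem _ (r.outerGrad_memLp ht).1 (r.measurable_outerGrad ht)) (r.memLp_sub ht.le))
  have h'' : ∀ ω, ∫ v, inner ℝ (A (x t ω) (P.f₁grad (y (t + 1) ω) v)) (x t ω - xs) ∂P₁
      = inner ℝ (A (x t ω) (gradient P.f₁ (y (t + 1) ω))) (x t ω - xs) := fun ω => by
    have e : ∀ v, inner ℝ (A (x t ω) (P.f₁grad (y (t + 1) ω) v)) (x t ω - xs) =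
        ((innerSL ℝ (x t ω - xs)).comp (A (x t ω))) (P.f₁grad (y (t + 1) ω) v) :=
      fun v => real_inner_comm (x t ω - xs) (A (x t ω) (P.f₁grad (y (t + 1) ω) v))
    simp_rw [e]
    rw [ContinuousLinearMap.integral_comp_comm _
      ((r.obj.f₁grad_memLp (y (t + 1) ω)).integrable one_le_two), r.obj.f₁grad_mean]
    exact real_inner_comm (A (x t ω) (gradient P.f₁ (y (t + 1) ω))) (x t ω - xs)
  refine le_trans ?_ h.ge
  refine le_trans ?_ h'.ge
  simp only [h'']
  refine integral_mono i1 (memLp_inner (hmem _ (r.memLp_gradient hy)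
    (r.continuous_gradient.measurable.comp hy)) (r.memLp_sub ht.le)) fun ω => ?_
  have h1 := r.obj.inner_gradient_subgradient_le r.mono (r.alg.mem ht.le ω) (y (t + 1) ω) xs
  rw [← neg_sub, inner_neg_right] at h1
  simp only [hAdef]
  rw [inner_sub_right]
  linarith

end Iteration

/-! ### Two estimates for real sequences. -/

theorem sum_inv_le_sqrt (T : ℕ) : ∑ t ∈ Finset.range T, (t : ℝ)⁻¹ ≤ √T := by
  -- The induction uses 1/T ≤ √(T+1) - √T, that is √(T+1) + √T ≤ T. From T = 6 on this follows from
  -- the linear bounds (T+1)/2 and (T-1)/2; smaller T are computed. The summand at 0 is 0.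
  have small : ∀ T : ℕ, T ≤ 6 → ∑ t ∈ Finset.range T, (t : ℝ)⁻¹ ≤ √T := by
    intro T hT
    apply Real.le_sqrt_of_sq_le
    interval_cases T <;> norm_num [Finset.sum_range_succ]
  rcases le_total T 6 with h | h
  · exact small T h
  · induction T, h using Nat.le_induction with
    | base => exact small 6 le_rfl
    | succ T hT ih =>
      rw [Finset.sum_range_succ]
      have hT' : (6 : ℝ) ≤ T := by exact_mod_cast hT
      have h0 : (0 : ℝ) < T := by linarith
      have h1 : √((T : ℝ) + 1) ≤ (T : ℝ) / 2 + 1 / 2 := by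
        rw [Real.sqrt_le_left (by linarith)]; nlinarith
      have h2 : √(T : ℝ) ≤ (T : ℝ) / 2 - 1 / 2 := by
        rw [Real.sqrt_le_left (by linarith)]; nlinarith
      have h3 : √((T : ℝ) + 1) ^ 2 = T + 1 := Real.sq_sqrt (by linarith)
      have h4 : √(T : ℝ) ^ 2 = T := Real.sq_sqrt h0.le
      have h5 : √(T : ℝ) ≤ √((T : ℝ) + 1) := Real.sqrt_le_sqrt (by linarith)
      have h6 : (T : ℝ)⁻¹ ≤ √((T : ℝ) + 1) - √(T : ℝ) := by
        rw [inv_le_iff_one_le_mul₀ h0]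
        nlinarith [mul_nonneg (sub_nonneg.2 h5)
          (by linarith : 0 ≤ (T : ℝ) - (√((T : ℝ) + 1) + √(T : ℝ)))]
      push_cast
      linarith

/-- The geometric sequence R (1 + κ)^T satisfies the recursion with equality, hence dominates. -/
theorem discrete_gronwall_sum {a : ℕ → ℝ} {R κ : ℝ} (hκ : 0 ≤ κ) {N : ℕ}
    (h : ∀ T ≤ N, a T ≤ R + κ * ∑ t ∈ Finset.range T, a t) {T : ℕ} (hT : T ≤ N) :
    a T ≤ R * (1 + κ) ^ T := by
  induction T using Nat.strong_induction_on with
  | _ T ih =>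
    have h1 : ∑ t ∈ Finset.range T, a t ≤ ∑ t ∈ Finset.range T, R * (1 + κ) ^ t :=
      Finset.sum_le_sum fun t ht => ih t (Finset.mem_range.1 ht)
        ((Finset.mem_range.1 ht).le.trans hT)
    have h2 : R + κ * ∑ t ∈ Finset.range T, R * (1 + κ) ^ t = R * (1 + κ) ^ T := by
      clear ih h1 hT
      induction T with
      | zero => simp
      | succ T ih =>
        rw [Finset.sum_range_succ, mul_add, ← add_assoc, ih]; ring
    exact (h T hT).trans (by rw [← h2]; gcongr)

/-! ### Expected gap, mean-square bound on the multipliers, and rates. -/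

section Rates

variable {dx dy m : ℕ} {Ξ₁ Ξ₂ Z Ω : Type*}
  [MeasurableSpace Ξ₁] [MeasurableSpace Ξ₂] [MeasurableSpace Z] [MeasurableSpace Ω]
  {μ : Measure Ω} [IsProbabilityMeasure μ]
  {P₁ : Measure Ξ₁} [IsProbabilityMeasure P₁] {P₂ : Measure Ξ₂} [IsProbabilityMeasure P₂]
  {PZ : Measure Z} [IsProbabilityMeasure PZ]
  {P : Problem dx dy m Ξ₁ Ξ₂ Z} {xs : Vec dx} {ls : Vec m}
  {Cf₁ Cf₂ σf₁ σf₂ Lf₁ DX Cg σg s : ℝ} {N : ℕ}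
  {ξ₁ : ℕ → Ω → Ξ₁} {ξ₂ : ℕ → Fin 2 → Ω → Ξ₂} {ζ : ℕ → Fin 2 → Ω → Z} {x₀ : Vec dx}
  {x : ℕ → Ω → Vec dx} {y : ℕ → Ω → Vec dy} {lam : ℕ → Ω → Vec m} {t : ℕ}

/-- The average of the iterates `x₁, …, x_T`. -/
noncomputable def iterateAverage {n : ℕ} (x : ℕ → Ω → Vec n) (T : ℕ) (ω : Ω) : Vec n :=
  (T : ℝ)⁻¹ • ∑ t ∈ Finset.range T, x (t + 1) ω

theorem ergodicAverage_eq {n : ℕ} (x : ℕ → Ω → Vec n) (T : ℕ) :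
    ergodicAverage T x = iterateAverage x T := by
  have h : ∀ ω, ∑ t ∈ Finset.Icc 1 T, x t ω = ∑ t ∈ Finset.range T, x (t + 1) ω := fun ω => by
    induction T with
    | zero => simp
    | succ T ih => rw [Finset.sum_Icc_succ_top (by omega), ih, Finset.sum_range_succ]
  funext ω
  rw [ergodicAverage, iterateAverage, h]

/-- The constant in the bound on the expected Lagrangian gap over multipliers of norm at most `c`. -/
noncomputable def gapConst (Cf₁ Cf₂ σf₂ Lf₁ DX Cg σg d c : ℝ) : ℝ :=
  8 / 15 * (Cf₁ ^ 2 * Cf₂ ^ 2) + 4 / 15 * (Cg ^ 2 * c ^ 2) + Cg ^ 2 * DX ^ 2 / 2 + σg ^ 2 / 4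
    + Lf₁ * σf₂ ^ 2 + 3 * Cf₁ * σf₂ + 15 / 4 * d ^ 2 + c ^ 2 + c * σg

variable (r : Run μ P₁ P₂ PZ P xs ls Cf₁ Cf₂ σf₁ σf₂ Lf₁ DX Cg σg s N ξ₁ ξ₂ ζ x₀ x y lam)

include r

/-- One summand of `pathwise_gap` in expectation. The two sampled-direction differences contribute
at most 0, and the noise paired with ∇f₁(y_t) contributes 0 because y_t precedes it. -/
theorem Run.iterate_term (ht : t < N) (c : ℝ) :
    IntegralLE μ (fun ω =>
      (inner ℝ (gradient P.f₁ (y (t + 1) ω)) (P.f₂ (x t ω) - P.f₂ xs)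
          - inner ℝ (P.objStep ξ₁ ξ₂ x y t ω) (x t ω - xs))
        + (inner ℝ (lam t ω) (P.gval (x t ω) (ζ t 1 ω))
          - inner ℝ (P.constrStep ζ x lam t ω) (x t ω - xs))
        - inner ℝ (gradient P.f₁ (y t ω)) (P.innerNoise ξ₂ x t ω)
        + Lf₁ / t * ‖P.innerNoise ξ₂ x t ω‖ ^ 2
        + (if t = 0 then 2 * Cf₁ * ‖P.innerNoise ξ₂ x t ω‖ else 0)
        + 4 / (15 * s) * (Cf₁ ^ 2 * Cf₂ ^ 2 + Cg ^ 2 * c ^ 2 + ‖P.objStep ξ₁ ξ₂ x y t ω‖ ^ 2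
            + ‖P.constrStep ζ x lam t ω‖ ^ 2)
        + ‖P.gval (x t ω) (ζ t 1 ω) - P.g xs‖ ^ 2 / (4 * s))
      (Lf₁ * σf₂ ^ 2 * (t : ℝ)⁻¹ + (if t = 0 then 2 * Cf₁ * σf₂ else 0)
        + 4 * Cg ^ 2 / (15 * s) * ∫ ω, ‖lam t ω‖ ^ 2 ∂μ
        + (4 / (15 * s) * (2 * (Cf₁ ^ 2 * Cf₂ ^ 2) + Cg ^ 2 * c ^ 2)
          + (2 * Cg ^ 2 * DX ^ 2 + σg ^ 2) / (4 * s))) := by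
  have hs := r.s_pos
  obtain ⟨-, hyb, -⟩ := r.measurable_before ht.le subset_rfl
  have hn := r.innerNoise_memLp ht
  have hgm := r.memLp_gradient (r.measurable ht.le).2.1
  have n1 : IntegralLE μ (fun ω => -inner ℝ (gradient P.f₁ (y t ω)) (P.innerNoise ξ₂ x t ω)) 0 := by
    refine ⟨(memLp_inner hgm hn.1).neg, ?_⟩
    rw [integral_neg, r.integral_inner_innerNoise ht
      (w := fun ω => gradient P.f₁ (y t ω)) (r.continuous_gradient.measurable.comp hyb) hgm, neg_zero]
  have n2 : IntegralLE μ (fun ω => ‖P.innerNoise ξ₂ x t ω‖ ^ 2) (σf₂ ^ 2) :=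
    ⟨hn.1.integrable_norm_pow', hn.2⟩
  have n3 : IntegralLE μ (fun ω => if t = 0 then 2 * Cf₁ * ‖P.innerNoise ξ₂ x t ω‖ else 0)
      (if t = 0 then 2 * Cf₁ * σf₂ else 0) := by
    split_ifs
    · exact IntegralLE.const_mul ⟨(hn.1.integrable one_le_two).norm,
        integral_norm_le_of_moment hn.1 r.obj.σf₂_pos.le hn.2⟩
        (mul_nonneg zero_le_two r.obj.Cf₁_pos.le)
    · exact IntegralLE.const 0
  have n4 : IntegralLE μ (fun ω => ‖P.objStep ξ₁ ξ₂ x y t ω‖ ^ 2) (Cf₁ ^ 2 * Cf₂ ^ 2) :=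
    ⟨(r.objStep_memLp ht).1.integrable_norm_pow', (r.objStep_memLp ht).2⟩
  have n5 : IntegralLE μ (fun ω => ‖P.constrStep ζ x lam t ω‖ ^ 2)
      (Cg ^ 2 * ∫ ω, ‖lam t ω‖ ^ 2 ∂μ) :=
    ⟨(r.constrStep_memLp ht).1.integrable_norm_pow', (r.constrStep_memLp ht).2⟩
  have h := ((((((r.integral_objStep ht).add (r.integral_constrStep ht)).add n1).add
    (n2.const_mul (div_nonneg r.obj.Lf₁_pos.le (Nat.cast_nonneg t)))).add n3).add
    ((((IntegralLE.const (Cf₁ ^ 2 * Cf₂ ^ 2 + Cg ^ 2 * c ^ 2)).add n4).add n5).const_mul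
      (c := 4 / (15 * s)) (by positivity))).add
    ((r.integral_gval_sub_sq ht).div_const (c := 4 * s) (by positivity))
  simp only [← sub_eq_add_neg] at h
  refine ⟨h.1, h.2.trans (le_of_eq ?_)⟩
  ring

/-- The bound on the expected Lagrangian gap. -/
theorem Run.expected_gap (hsN : s = √N) {T : ℕ} (hT0 : 0 < T) (hT : T ≤ N) {c : ℝ} (hc : 0 ≤ c)
    {G : Ω → ℝ} (hG : Integrable G μ)
    (hl : ∀ ω, ∃ l ∈ nonnegOrthant m, ‖l‖ ≤ c ∧
      G ω ≤ T * (P.F (iterateAverage x T ω) - P.F xs + inner ℝ l (P.g (iterateAverage x T ω)))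
        + s * ‖lam T ω - l‖ ^ 2) :
    ∫ ω, G ω ∂μ ≤ s * gapConst Cf₁ Cf₂ σf₂ Lf₁ DX Cg σg ‖x₀ - xs‖ c
      + 4 * Cg ^ 2 / (15 * s) * ∑ t ∈ Finset.range T, ∫ ω, ‖lam t ω‖ ^ 2 ∂μ := by
  have hs := r.s_pos
  have h := ((((IntegralLE.sum fun t (ht : t < T) => r.iterate_term (ht.trans_le hT) c).add
    ((r.integral_norm_sum_innerNoise hT).const_mul r.obj.Cf₁_pos.le)).add
    ((r.integral_norm_sum_constrNoise hT).const_mul hc)).add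
    (IntegralLE.const (15 * s / 4 * ‖x₀ - xs‖ ^ 2))).add (IntegralLE.const (s * c ^ 2))
  refine (integral_mono hG h.1 fun ω => ?_).trans (h.2.trans ?_)
  -- The multiplier may change with ω, without any measurability: only G and the bound uniform over
  -- ‖l‖ ≤ c are integrated.
  · obtain ⟨l, hl0, hlc, hGl⟩ := hl ω
    refine hGl.trans ?_
    have := pathwise_gap r.obj r.con r.mono r.saddle hs hT0 (fun t => x t ω)
      (fun t => P.objStep ξ₁ ξ₂ x y t ω) (fun t => P.constrStep ζ x lam t ω) (fun t => y t ω)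
      (fun t => P.f₂val (x t ω) (ξ₂ t 1 ω)) (fun t => lam t ω)
      (fun t => P.gval (x t ω) (ζ t 1 ω)) (fun t ht => r.alg.mem (ht.trans hT) ω)
      (r.alg.lam_zero ω) (fun t ht => r.alg.y_step t (ht.trans_le hT) ω)
      (fun t ht => r.alg.x_step t (ht.trans_le hT) ω)
      (fun t ht => r.alg.lam_step t (ht.trans_le hT) ω) hl0 hlc
    simp only [r.alg.x_zero] at this
    exact this
  -- With T ≤ N = s², the terms of order T/s and √T and the single term from t = 0 are all at most
  -- constants times s.
  · have hTs : (T : ℝ) ≤ s ^ 2 := by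
      rw [hsN, Real.sq_sqrt (Nat.cast_nonneg N)]; exact_mod_cast hT
    have hTs' : √(T : ℝ) ≤ s := by
      rw [hsN]; exact Real.sqrt_le_sqrt (by exact_mod_cast hT)
    have hs1 : 1 ≤ s := le_trans (Real.one_le_sqrt.2 (by exact_mod_cast hT0)) hTs'
    have e1 : ∑ t ∈ Finset.range T, (if t = 0 then 2 * Cf₁ * σf₂ else 0) = 2 * Cf₁ * σf₂ := by
      rw [Finset.sum_ite_eq' (Finset.range T) 0]; simp [hT0]
    rw [Finset.sum_add_distrib, Finset.sum_add_distrib, Finset.sum_add_distrib, e1,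
      ← Finset.mul_sum, ← Finset.mul_sum, Finset.sum_const, Finset.card_range, nsmul_eq_mul]
    have a1 : Lf₁ * σf₂ ^ 2 * ∑ t ∈ Finset.range T, (t : ℝ)⁻¹ ≤ Lf₁ * σf₂ ^ 2 * s :=
      mul_le_mul_of_nonneg_left ((sum_inv_le_sqrt T).trans hTs')
        (mul_nonneg r.obj.Lf₁_pos.le (by positivity))
    have hC0 : 0 ≤ Cf₁ * σf₂ := mul_nonneg r.obj.Cf₁_pos.le r.obj.σf₂_pos.le
    have a2 : 2 * Cf₁ * σf₂ ≤ 2 * (Cf₁ * σf₂) * s := by nlinarith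
    have a3 : Cf₁ * (√T * σf₂) ≤ Cf₁ * σf₂ * s := by
      nlinarith [mul_le_mul_of_nonneg_left hTs' hC0]
    have a4 : c * (√T * σg) ≤ c * σg * s := by
      nlinarith [mul_le_mul_of_nonneg_left hTs' (mul_nonneg hc r.con.σg_pos.le)]
    have a5 : (T : ℝ) * (4 / (15 * s) * (2 * (Cf₁ ^ 2 * Cf₂ ^ 2) + Cg ^ 2 * c ^ 2)
          + (2 * Cg ^ 2 * DX ^ 2 + σg ^ 2) / (4 * s))
        ≤ s ^ 2 * (4 / (15 * s) * (2 * (Cf₁ ^ 2 * Cf₂ ^ 2) + Cg ^ 2 * c ^ 2)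
          + (2 * Cg ^ 2 * DX ^ 2 + σg ^ 2) / (4 * s)) :=
      mul_le_mul_of_nonneg_right hTs (by positivity)
    have e2 : s ^ 2 * (4 / (15 * s) * (2 * (Cf₁ ^ 2 * Cf₂ ^ 2) + Cg ^ 2 * c ^ 2)
          + (2 * Cg ^ 2 * DX ^ 2 + σg ^ 2) / (4 * s))
        = s * (8 / 15 * (Cf₁ ^ 2 * Cf₂ ^ 2) + 4 / 15 * (Cg ^ 2 * c ^ 2) + Cg ^ 2 * DX ^ 2 / 2
          + σg ^ 2 / 4) := by field_simp; ring
    unfold gapConst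
    linarith

theorem Run.iterateAverage_mem {T : ℕ} (hT0 : 0 < T) (hT : T ≤ N) (ω : Ω) :
    iterateAverage x T ω ∈ P.X :=
  average_mem r.obj.convex_X (fun t => x (t + 1) ω) hT0
    fun _ ht => r.alg.mem (Nat.succ_le_of_lt (ht.trans_le hT)) ω

theorem Run.measurable_iterateAverage {T : ℕ} (hT : T ≤ N) : Measurable (iterateAverage x T) :=
  (Finset.measurable_fun_sum _ fun _ ht =>
    (r.measurable (Nat.succ_le_of_lt ((Finset.mem_range.1 ht).trans_le hT))).1).const_smul (T : ℝ)⁻¹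

theorem Run.integrable_comp_iterateAverage {T : ℕ} (hT0 : 0 < T) (hT : T ≤ N) {φ : Vec dx → ℝ}
    (hφ : Continuous φ) : Integrable (fun ω => φ (iterateAverage x T ω)) μ := by
  obtain ⟨B, hB⟩ := exists_norm_le_of_continuous r.obj hφ
  exact Integrable.of_bound
    (hφ.measurable.comp (r.measurable_iterateAverage hT)).aestronglyMeasurable B
    (Filter.Eventually.of_forall fun ω => hB _ (r.iterateAverage_mem hT0 hT ω))

theorem Run.memLp_lam_sub (ht : t ≤ N) : MemLp (fun ω => lam t ω - ls) 2 μ :=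
  (r.memLp_lam ht).sub (memLp_const ls)

theorem Run.integral_lam_sq_le (ht : t ≤ N) :
    ∫ ω, ‖lam t ω‖ ^ 2 ∂μ ≤ 2 * ‖ls‖ ^ 2 + 2 * ∫ ω, ‖lam t ω - ls‖ ^ 2 ∂μ := by
  have i1 : Integrable (fun ω => ‖lam t ω - ls‖ ^ 2) μ := (r.memLp_lam_sub ht).integrable_norm_pow'
  have h : ∫ ω, ‖lam t ω‖ ^ 2 ∂μ ≤ ∫ ω, (2 * ‖ls‖ ^ 2 + 2 * ‖lam t ω - ls‖ ^ 2) ∂μ := by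
    refine integral_mono (r.memLp_lam ht).integrable_norm_pow'
      ((integrable_const _).add (i1.const_mul 2)) fun ω => ?_
    have h1 : ‖lam t ω‖ ≤ ‖ls‖ + ‖lam t ω - ls‖ := by
      simpa using norm_add_le ls (lam t ω - ls)
    have := pow_le_pow_left₀ (norm_nonneg _) h1 2
    simp only
    nlinarith [sq_nonneg (‖ls‖ - ‖lam t ω - ls‖)]
  rw [integral_add (integrable_const _) (i1.const_mul 2),
    integral_const_mul (2 : ℝ) fun ω => ‖lam t ω - ls‖ ^ 2] at h
  simpa using h

/-- The multipliers are bounded in mean square. -/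
theorem Run.integral_lam_sub_sq_le (hsN : s = √N) {R : ℝ}
    (hR : R = rateR Cf₁ Cf₂ σf₂ Lf₁ DX Cg σg x₀ xs (0 : Vec m) ls) (ht : t ≤ N) :
    ∫ ω, ‖lam t ω - ls‖ ^ 2 ∂μ ≤ R * Real.exp (2 * Cg ^ 2) := by
  have hs := r.s_pos
  have hsq : s ^ 2 = N := by rw [hsN, Real.sq_sqrt (Nat.cast_nonneg N)]
  have hN : (0 : ℝ) < N := by rw [← hsq]; positivity
  have p1 := mul_pos r.obj.Cf₁_pos r.obj.σf₂_pos
  have p2 := mul_nonneg r.obj.Lf₁_pos.le (sq_nonneg σf₂)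
  have p3 := mul_nonneg (norm_nonneg ls) r.con.σg_pos.le
  have p4 : 0 ≤ Cf₁ ^ 2 * Cf₂ ^ 2 := by positivity
  have p5 : 0 ≤ Cg ^ 2 * ‖ls‖ ^ 2 := by positivity
  have hR1 : gapConst Cf₁ Cf₂ σf₂ Lf₁ DX Cg σg ‖x₀ - xs‖ ‖ls‖
      + 8 / 15 * (Cg ^ 2 * ‖ls‖ ^ 2) ≤ R := by
    rw [hR]
    unfold rateR gapConst
    rw [zero_sub, norm_neg]
    nlinarith [sq_nonneg σg]
  have hR2 : ‖ls‖ ^ 2 ≤ R := by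
    rw [hR]
    unfold rateR
    rw [zero_sub, norm_neg]
    nlinarith [sq_nonneg σg, sq_nonneg ‖x₀ - xs‖, mul_nonneg (sq_nonneg DX) (sq_nonneg Cg)]
  have hR0 : 0 ≤ R := (sq_nonneg _).trans hR2
  -- The coefficient 4Cg²/(15s) is doubled when ‖λ_t‖² is split around `ls` and divided by s, with
  -- s² = N. Then N κ = 8/15 Cg², well below the exponent 2Cg².
  set κ := 8 * Cg ^ 2 / (15 * N) with hκ
  have hκ0 : 0 ≤ κ := by positivity
  have hrec : ∀ T ≤ N, ∫ ω, ‖lam T ω - ls‖ ^ 2 ∂μ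
      ≤ R + κ * ∑ t ∈ Finset.range T, ∫ ω, ‖lam t ω - ls‖ ^ 2 ∂μ := by
    intro T hT
    rcases Nat.eq_zero_or_pos T with rfl | hT0
    · simp only [r.alg.lam_zero, zero_sub, norm_neg, integral_const, probReal_univ, one_smul,
        Finset.range_zero, Finset.sum_empty, mul_zero, add_zero]
      exact hR2
    · have hi : Integrable (fun ω => s * ‖lam T ω - ls‖ ^ 2) μ :=
        Integrable.const_mul (r.memLp_lam_sub hT).integrable_norm_pow' s
      -- For l = `ls` the gap at the average is nonnegative and is dropped; the squared distance of
      -- the multipliers remains.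
      have h1 := r.expected_gap hsN hT0 hT (norm_nonneg ls) hi fun ω =>
        ⟨ls, r.saddle.dual_mem, le_rfl, le_add_of_nonneg_left (mul_nonneg (Nat.cast_nonneg T)
          (r.saddle.gap_nonneg (r.iterateAverage_mem hT0 hT ω)))⟩
      rw [integral_const_mul] at h1
      have h2 : ∑ t ∈ Finset.range T, ∫ ω, ‖lam t ω‖ ^ 2 ∂μ ≤
          2 * N * ‖ls‖ ^ 2 + 2 * ∑ t ∈ Finset.range T, ∫ ω, ‖lam t ω - ls‖ ^ 2 ∂μ := by
        refine (Finset.sum_le_sum fun t ht => r.integral_lam_sq_le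
          ((Finset.mem_range.1 ht).le.trans hT)).trans ?_
        rw [Finset.sum_add_distrib, Finset.mul_sum, Finset.sum_const, Finset.card_range,
          nsmul_eq_mul]
        have : (T : ℝ) ≤ N := by exact_mod_cast hT
        nlinarith [sq_nonneg ‖ls‖]
      have h3 := mul_le_mul_of_nonneg_left h2 (by positivity : 0 ≤ 4 * Cg ^ 2 / (15 * s))
      set S := ∑ t ∈ Finset.range T, ∫ ω, ‖lam t ω - ls‖ ^ 2 ∂μ
      have h4 : 4 * Cg ^ 2 / (15 * s) * (2 * N * ‖ls‖ ^ 2 + 2 * S)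
          = s * (8 / 15 * (Cg ^ 2 * ‖ls‖ ^ 2) + κ * S) := by
        rw [hκ, ← hsq]; field_simp; ring
      have h5 : s * ∫ ω, ‖lam T ω - ls‖ ^ 2 ∂μ ≤ s * (R + κ * S) := by nlinarith
      exact le_of_mul_le_mul_left h5 hs
  have hmain := discrete_gronwall_sum hκ0 hrec ht
  refine hmain.trans (mul_le_mul_of_nonneg_left ?_ hR0)
  calc (1 + κ) ^ t ≤ (Real.exp κ) ^ t :=
        pow_le_pow_left₀ (by positivity) (by rw [add_comm]; exact Real.add_one_le_exp κ) t
    _ = Real.exp (t * κ) := (Real.exp_nat_mul κ t).symm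
    _ ≤ Real.exp (2 * Cg ^ 2) := by
        refine Real.exp_le_exp.2 ?_
        have h1 : (t : ℝ) * κ ≤ N * κ :=
          mul_le_mul_of_nonneg_right (by exact_mod_cast ht) hκ0
        have h2 : (N : ℝ) * κ = 8 / 15 * Cg ^ 2 := by rw [hκ]; field_simp
        nlinarith [sq_nonneg Cg]

/-- The bound on the expected Lagrangian gap after all iterations. -/
theorem Run.expected_gap_final (hsN : s = √N) {R : ℝ}
    (hR : R = rateR Cf₁ Cf₂ σf₂ Lf₁ DX Cg σg x₀ xs (0 : Vec m) ls) {c : ℝ} (hc : 0 ≤ c)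
    {G : Ω → ℝ} (hG : Integrable G μ)
    (hl : ∀ ω, ∃ l ∈ nonnegOrthant m, ‖l‖ ≤ c ∧
      G ω ≤ P.F (iterateAverage x N ω) - P.F xs + inner ℝ l (P.g (iterateAverage x N ω))) :
    ∫ ω, G ω ∂μ ≤ 1 / s * (gapConst Cf₁ Cf₂ σf₂ Lf₁ DX Cg σg ‖x₀ - xs‖ c
      + 4 / 15 * Cg ^ 2 * (2 * ‖ls‖ ^ 2 + 2 * (R * Real.exp (2 * Cg ^ 2)))) := by
  have hs := r.s_pos
  have hsq : s ^ 2 = N := by rw [hsN, Real.sq_sqrt (Nat.cast_nonneg N)]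
  have hN : (0 : ℝ) < N := by rw [← hsq]; positivity
  have h1 := r.expected_gap hsN (by exact_mod_cast hN) le_rfl hc (hG.const_mul (N : ℝ)) fun ω => by
    obtain ⟨l, hl0, hlc, hGl⟩ := hl ω
    exact ⟨l, hl0, hlc, (mul_le_mul_of_nonneg_left hGl hN.le).trans
      (le_add_of_nonneg_right (by positivity))⟩
  rw [integral_const_mul] at h1
  set M := 2 * ‖ls‖ ^ 2 + 2 * (R * Real.exp (2 * Cg ^ 2)) with hM
  have h2 : ∑ t ∈ Finset.range N, ∫ ω, ‖lam t ω‖ ^ 2 ∂μ ≤ N * M := by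
    refine (Finset.sum_le_sum (g := fun _ => M) fun t ht => ?_).trans ?_
    · have ht := (Finset.mem_range.1 ht).le
      linarith [r.integral_lam_sq_le ht, r.integral_lam_sub_sq_le hsN hR ht]
    · rw [Finset.sum_const, Finset.card_range, nsmul_eq_mul]
  have h3 := mul_le_mul_of_nonneg_left h2 (by positivity : 0 ≤ 4 * Cg ^ 2 / (15 * s))
  have h4 : 4 * Cg ^ 2 / (15 * s) * (N * M) = s * (4 / 15 * Cg ^ 2 * M) := by
    rw [← hsq]; field_simp
  rw [← hsq] at h1
  set K := gapConst Cf₁ Cf₂ σf₂ Lf₁ DX Cg σg ‖x₀ - xs‖ c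
  rw [one_div, ← div_eq_inv_mul, le_div_iff₀ hs]
  have h5 : s * ((∫ ω, G ω ∂μ) * s) ≤ s * (K + 4 / 15 * Cg ^ 2 * M) := by nlinarith
  exact le_of_mul_le_mul_left h5 hs

end Rates

end ECSCO

/-! ### Choice of the multipliers. -/

theorem mainTheorem1 {dx dy m : ℕ} {Ξ₁ Ξ₂ Z Ω : Type*}
    [MeasurableSpace Ξ₁] [MeasurableSpace Ξ₂] [MeasurableSpace Z] [MeasurableSpace Ω]
    (μ : Measure Ω) [IsProbabilityMeasure μ]
    (P₁ : Measure Ξ₁) [IsProbabilityMeasure P₁] (P₂ : Measure Ξ₂) [IsProbabilityMeasure P₂]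
    (PZ : Measure Z) [IsProbabilityMeasure PZ]
    (P : ECSCO.Problem dx dy m Ξ₁ Ξ₂ Z) (hP : P.MeasurableOracle)
    (xs : ECSCO.Vec dx) (ls : ECSCO.Vec m) (hsaddle : P.IsSaddle xs ls)
    (Cf₁ Cf₂ σf₁ σf₂ Lf₁ DX Cg σg : ℝ)
    (hobj : P.ObjectiveAssumption P₁ P₂ xs Cf₁ Cf₂ σf₁ σf₂ Lf₁ DX)
    (hcon : P.ConstraintAssumption PZ Cg σg)
    (hmono : P.MonotoneAssumption)
    (N : ℕ) (hN : 3 * Cg ^ 2 / 2 ≤ (N : ℝ))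
    (ξ₁ : ℕ → Ω → Ξ₁) (ξ₂ : ℕ → Fin 2 → Ω → Ξ₂) (ζ : ℕ → Fin 2 → Ω → Z)
    (hsamples : ECSCO.IndependentSamples μ P₁ P₂ PZ N ξ₁ ξ₂ ζ)
    (x₀ : ECSCO.Vec dx)
    (x : ℕ → Ω → ECSCO.Vec dx) (y : ℕ → Ω → ECSCO.Vec dy) (lam : ℕ → Ω → ECSCO.Vec m)
    (halg : P.IsECSCGD N (fun t => (t : ℝ) / 2) (fun _ => 2 * √(N : ℝ))
      (fun _ => 15 * √(N : ℝ) / 2) x₀ 0 ξ₁ ξ₂ ζ x y lam)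
    (R : ℝ) (hR : R = ECSCO.rateR Cf₁ Cf₂ σf₂ Lf₁ DX Cg σg x₀ xs (0 : ECSCO.Vec m) ls) :
    (Integrable (fun ω => P.F (ECSCO.ergodicAverage N x ω)) μ ∧
      (∫ ω, P.F (ECSCO.ergodicAverage N x ω) ∂μ) - P.F xs ≤
        1 / √(N : ℝ) *
          (6 * Cf₁ ^ 2 * Cf₂ ^ 2 + Lf₁ * σf₂ ^ 2 + 3 * Cf₁ * σf₂ + 15 / 4 * ‖x₀ - xs‖ ^ 2
            + DX ^ 2 * Cg ^ 2 / 2 + σg ^ 2 / 2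
            + (4 * ‖ls‖ ^ 2 + 8 * R * Real.exp (2 * Cg ^ 2)) * Cg ^ 2 / 3)) ∧
    (Integrable (fun ω => ‖ECSCO.vecPos (P.g (ECSCO.ergodicAverage N x ω))‖) μ ∧
      (∫ ω, ‖ECSCO.vecPos (P.g (ECSCO.ergodicAverage N x ω))‖ ∂μ) ≤
        1 / √(N : ℝ) *
          (6 * Cf₁ ^ 2 * Cf₂ ^ 2 + Lf₁ * σf₂ ^ 2 + 3 * Cf₁ * σf₂ + 15 / 4 * ‖x₀ - xs‖ ^ 2
            + DX ^ 2 * Cg ^ 2 / 2 + σg ^ 2 / 2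
            + (2 * ‖ls‖ ^ 2 + 4 * R * Real.exp (2 * Cg ^ 2)) * Cg ^ 2
            + (2 * Cg ^ 2 + 1) * (‖ls‖ + 1) ^ 2 + (‖ls‖ + 1) * σg)) := by
  have hN0 : 0 < (N : ℝ) := lt_of_lt_of_le (by have := hcon.Cg_pos; positivity) hN
  have hs : 0 < √(N : ℝ) := Real.sqrt_pos.2 hN0
  have hNpos : 0 < N := by exact_mod_cast hN0
  have r : ECSCO.Run μ P₁ P₂ PZ P xs ls Cf₁ Cf₂ σf₁ σf₂ Lf₁ DX Cg σg √(N : ℝ) N ξ₁ ξ₂ ζ x₀ x y lam :=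
    ⟨hP, hsaddle, hobj, hcon, hmono, hsamples, hs, halg⟩
  have hR0 : 0 ≤ R * Real.exp (2 * Cg ^ 2) :=
    (integral_nonneg fun _ => by positivity).trans (r.integral_lam_sub_sq_le rfl hR le_rfl)
  have hp1 : 0 ≤ Cg ^ 2 * ‖ls‖ ^ 2 := by positivity
  have hp2 : 0 ≤ Cg ^ 2 * (R * Real.exp (2 * Cg ^ 2)) := mul_nonneg (sq_nonneg _) hR0
  have hp3 : 0 ≤ Cf₁ ^ 2 * Cf₂ ^ 2 := by positivity
  have hp4 := sq_nonneg σg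
  rw [ECSCO.ergodicAverage_eq]
  have iF := r.integrable_comp_iterateAverage hNpos le_rfl r.continuous_F
  have ig := r.integrable_comp_iterateAverage hNpos le_rfl
    (φ := fun z => ‖ECSCO.vecPos (P.g z)‖) (ECSCO.continuous_vecPos.comp r.continuous_g).norm
  refine ⟨⟨iF, ?_⟩, ig, ?_⟩
  -- The multiplier 0, with c = 0, isolates the objective.
  · have h := r.expected_gap_final rfl hR le_rfl (iF.sub (integrable_const (P.F xs))) fun ω =>
      ⟨0, fun j => by simp, by simp, by simp⟩
    simp only [Pi.sub_apply] at h
    rw [integral_sub iF (integrable_const _)] at h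
    simp only [integral_const, probReal_univ, one_smul] at h
    refine h.trans (mul_le_mul_of_nonneg_left ?_ (by positivity))
    unfold ECSCO.gapConst
    linarith
  · have h := r.expected_gap_final rfl hR (c := ‖ls‖ + 1) (by positivity) ig fun ω => ?_
    · refine h.trans (mul_le_mul_of_nonneg_left ?_ (by positivity))
      have hp5 : 0 ≤ Cg ^ 2 * (‖ls‖ + 1) ^ 2 := by positivity
      unfold ECSCO.gapConst
      linarith
    · set z := ECSCO.iterateAverage x N ω
      have hz : z ∈ P.X := r.iterateAverage_mem hNpos le_rfl ω
      have hgap := hsaddle.gap_nonneg hz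
      have h1 : inner ℝ ls (P.g z) ≤ ‖ls‖ * ‖ECSCO.vecPos (P.g z)‖ :=
        (ECSCO.inner_mono_of_nonneg hsaddle.dual_mem fun j => le_max_left _ _).trans
          (real_inner_le_norm _ _)
      have hm := ECSCO.vecPos_mem (P.g z)
      have hsq := ECSCO.norm_vecPos_sq (P.g z)
      set v := ECSCO.vecPos (P.g z)
      -- The saddle property gives F(x̄) - F(x*) ≥ -‖ls‖ ‖v‖, while this multiplier contributes
      -- (‖ls‖ + 1) ‖v‖, leaving at least ‖v‖. If v = 0, the inverse is 0 and the multiplier is 0,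
      -- which is still admissible.
      refine ⟨((‖ls‖ + 1) * ‖v‖⁻¹) • v, fun j => ?_, ?_, ?_⟩
      · rw [PiLp.smul_apply, smul_eq_mul]
        exact mul_nonneg (by positivity) (hm j)
      · rw [norm_smul, Real.norm_of_nonneg (by positivity), mul_assoc]
        exact mul_le_of_le_one_right (by positivity) inv_mul_le_one
      · rw [real_inner_smul_left, hsq]
        have e : (‖ls‖ + 1) * ‖v‖⁻¹ * ‖v‖ ^ 2 = (‖ls‖ + 1) * ‖v‖ := by
          rcases eq_or_ne ‖v‖ 0 with h0 | h0
          · simp [h0]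
          · field_simp
        rw [e]
        linarith
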